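/- **Setting.** Let $r\in\mathbb{Q}^\times$ and $f_r(t)=-r\big((1-t)^{1/r}-1\big)=-r\sum_{k\ge1}(-1)^k\binom{1/r}{k}t^k\in\mathbb{Q}[[t]]$. Let $P_r$ be the finite set of non-archimedean places $\mathfrak p$ of $\mathbb{Q}$ with $v_{\mathfrak p}(r)\neq0$. The residue characteristic $\operatorname{res.char}(\mathfrak p)$ is $p$ if $\mathfrak p$ is the $p$-adic place, and $0$ if $\mathfrak p$ is archimedean. Fix $\theta\in\mathbb{R}$, let $R_\theta=\{ae^{i\theta}:a\ge0\}$, and define complex powers $w^s=\exp(s\log_\theta w)$ by the branch $\log_\theta$ of the logarithm on $\mathbb{C}^\times$ with imaginary part in $(\theta-2\pi,\theta]$. If $r<0$, assume $r\notin R_\theta$, i.e. $\theta\not\equiv\pi \pmod{2\pi}$. *Non-archimedean places.* Let $\mathfrak p\notin P_r$ be the $p$-adic place. Let $\phi_{f_r}:\mathbb{Z}_p\to\mathbb{C}_p$ be the unique continuous function with $\sum_{n\ge0}\phi_{f_r}(n)\,t^n/n!=\exp(f_r(t))$, and put $\Phi_{f_r,\mathfrak p}(y)=\sum_{k\ge0}k!\,\phi_{f_r}(-1-k)\binom{y}{k}$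 for $y\in\mathbb{Z}_p$. Let $\omega_{\mathfrak p}(r)$ be the unique root of unity in $\mathbb{C}_p$ of order prime to $p$ with $|r-\omega_{\mathfrak p}(r)|_p<1$, and let $\langle r\rangle_{\mathfrak p}=r/\omega_{\mathfrak p}(r)$. For $s\in\mathbb{Z}_p$ set $$\Psi_{r,\mathfrak p}(s)=\langle r\rangle_{\mathfrak p}^{\,s}\;\Phi_{f_r,\mathfrak p}\big(\tfrac1r(s+1)-1\big).$$ *The archimedean place.* Put $\langle r\rangle_{\mathfrak p}=r$, let $\phi_{f_r}(x)=\exp(\widehat f(x))$ for $x\le0$, where $\widehat f$ is the analytic continuation of $f_r$ along $(-\infty,0]$, and put $\Phi_{f_r,\mathfrak p}(s)=\int_{-\infty}^0(1-x)^s\phi_{f_r}(x)\,dx$, where $(1-x)^s=\exp(s\log(1-x))$ with the real logarithm. If $r>0$, set $\Psi_{r,\mathfrak p}(s)=r^s\,\Phi_{f_r,\mathfrak p}(\tfrac1r(s+1)-1)$ for $s\in\mathbb{C}$. If $r<0$, set, for $\operatorname{Re}s>-1$, $$\Psi_{r,\mathfrak p}(s)=r^s\,\Phi_{f_r,\mathfrak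 p}\big(\tfrac1r(s+1)-1\big)+e^{r}\,\widehat\Gamma(s+1),\qquad \widehat\Gamma(s)=\Gamma^\theta(s,r)+\gamma^\theta(s,r).$$ Here $\gamma^\theta(s,r)=\lim_{N\to\infty}\int_{1/N}^1(tr)^{s-1}e^{-tr}r\,dt$, and $\Gamma^\theta(s,r)=\lim_{N\to\infty}\int_{\kappa|_{[0,N]}}u^{s-1}e^{-u}\,du$ for any $\kappa:[0,\infty)\to\mathbb{C}\setminus R_\theta$ such that $\kappa$ is continuous and piecewise $C^1$ on each $[0,\nu]$, $\kappa(0)=r$, $|\kappa(t)|\to\infty$, and, for all large $t$, $\kappa(t)$ lies in a fixed closed subsector of the open right half-plane and, if $\cos\theta>0$, on or below $R_\theta$. **Theorem.** (i) There is a sequence of rational numbers $(\widetilde\Psi(m))_{m\ge0}$, depending only on $r$, with $\widetilde\Psi(0)=1$ and $\widetilde\Psi(m)=1+\frac mr\widetilde\Psi(m-1)$ for all $m\ge1$, such that for every place $\mathfrak p\notin P_r$ of $\mathbb{Q}$ and every integer $m\ge0$, $$\langle r\rangle_{\mathfrak p}^{-m}\,\Psi_{r,\mathfrak p}(m)=\widetilde\Psi(m).$$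 In particular, for all places $\mathfrak p,\mathfrak q\notin P_r$ and all $m\ge0$, $\langle r\rangle_{\mathfrak p}^{-m}\Psi_{r,\mathfrak p}(m)=\langle r\rangle_{\mathfrak q}^{-m}\Psi_{r,\mathfrak q}(m)$, as an equality of elements of $\mathbb{Q}$. (ii) If $\mathfrak p,\mathfrak q\notin P_r$ are places of $\mathbb{Q}$ and $m\ge0$ is an integer divisible by $\operatorname{lcm}(\operatorname{res.char}(\mathfrak p)-1,\operatorname{res.char}(\mathfrak q)-1)$, then $\Psi_{r,\mathfrak p}(m)=\Psi_{r,\mathfrak q}(m)$, both sides being the same rational number. -/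

import Mathlib

noncomputable section

namespace IncGamma

/-! ### Places of the rational numbers -/

/-- The places of `ℚ`: the archimedean one, and one for every prime number.
See `RatPlace.existsUnique_isEquiv` for the comparison with classes of absolute values. -/
inductive RatPlace : Type
  | infinite : RatPlace
  | finite (p : ℕ) [hp : Fact p.Prime] : RatPlace

namespace RatPlace

/-- The canonical absolute value representing a place. -/
def absVal : RatPlace → AbsoluteValue ℚ ℝ
  | infinite => Rat.AbsoluteValue.real
  | finite p => Rat.AbsoluteValue.padic p

/-- The residue characteristic, which is `0` for the archimedean place. -/
def resChar : RatPlace → ℕ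
  | infinite => 0
  | finite p => p

/-- The field `Ω` attached to a place: `ℂ` or `ℂ_p`. -/
def Omega : RatPlace → Type
  | infinite => ℂ
  | finite p => ℂ_[p]

instance instFieldOmega : (P : RatPlace) → Field P.Omega
  | infinite => inferInstanceAs (Field ℂ)
  | finite p => inferInstanceAs (Field ℂ_[p])

/-- The domain of the transformed functions: `ℂ` or `ℤ_p`. -/
def Post : RatPlace → Type
  | infinite => ℂ
  | finite p => ℤ_[p]

instance instCommRingPost : (P : RatPlace) → CommRing P.Post
  | infinite => inferInstanceAs (CommRing ℂ)
  | finite p => inferInstanceAs (CommRing ℤ_[p])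

/-- Every nontrivial absolute value on `ℚ` is equivalent to `P.absVal` for exactly one `P`. -/
theorem existsUnique_isEquiv (v : AbsoluteValue ℚ ℝ) (hv : v.IsNontrivial) :
    ∃! P : RatPlace, v.IsEquiv P.absVal := by
  rcases Rat.AbsoluteValue.equiv_real_or_padic v hv with h | ⟨p, ⟨hp, h⟩, huniq⟩
  · refine ⟨infinite, h, ?_⟩
    rintro (_ | ⟨q⟩) hQ
    · rfl
    · exact absurd (h.symm.trans hQ) (Rat.AbsoluteValue.not_real_isEquiv_padic q)
  · refine ⟨@finite p hp, h, ?_⟩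
    rintro (_ | @⟨q, hq⟩) hQ
    · exact absurd (hQ.symm.trans h) (Rat.AbsoluteValue.not_real_isEquiv_padic p)
    · obtain rfl := huniq q ⟨hq, hQ⟩
      rfl

end RatPlace

/-- The set `P_r` of non-archimedean places `P` of `ℚ` at which `r` has nonzero valuation. -/
def badPlaces (r : ℚ) : Set RatPlace :=
  {P | ∃ (p : ℕ) (_ : Fact p.Prime), P = RatPlace.finite p ∧ padicValRat p r ≠ 0}

/-! ### The power series `f_r` -/

/-- `f_r(t) = -r ((1 - t)^(1/r) - 1) = -r ∑_{k ≥ 1} (-1)^k (1/r choose k) t^k`. -/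
def fSeries (r : ℚ) : PowerSeries ℚ :=
  PowerSeries.mk fun k => if k = 0 then 0 else -r * ((-1) ^ k * Ring.choose (1 / r) k)

/-! ### The `p`-adic side -/

section Padic

variable (p : ℕ) [Fact p.Prime]

/-- The inclusion of `ℤ_p` in `ℂ_p`. -/
def zpToCp : ℤ_[p] →+* ℂ_[p] :=
  (algebraMap ℚ_[p] ℂ_[p]).comp (PadicInt.Coe.ringHom (p := p))

/-- A `p`-integral rational number, viewed in `ℤ_p` (and `0` if it is not `p`-integral). -/
def ratToZp (q : ℚ) : ℤ_[p] :=
  open Classical in if h : ‖(q : ℚ_[p])‖ ≤ 1 then ⟨(q : ℚ_[p]), h⟩ else 0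

/-- `exp(f(0)) exp(f(t) - f(0))`, for a power series `f` over `ℂ_p` whose constant term lies in
the disc of convergence of the exponential. -/
def gexp (f : PowerSeries ℂ_[p]) : PowerSeries ℂ_[p] :=
  PowerSeries.C (NormedSpace.exp (PowerSeries.constantCoeff f)) *
    (PowerSeries.exp ℂ_[p]).subst (f - PowerSeries.C (PowerSeries.constantCoeff f))

/-- The (unique) continuous function `φ_f : ℤ_p → ℂ_p` such that
`∑ φ_f(n) t^n / n!` is `gexp f`. -/
def phiPadic (f : PowerSeries ℂ_[p]) : C(ℤ_[p], ℂ_[p]) :=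
  open Classical in
  if h : ∃ φ : C(ℤ_[p], ℂ_[p]),
      PowerSeries.mk (fun n : ℕ => φ (n : ℤ_[p]) / (Nat.factorial n : ℂ_[p])) = gexp p f
  then h.choose else 0

/-- The two-variable transform
`(x, y) ↦ ∑_k (-1)^k k! (y choose k) (x choose k) φ(x - k)`. -/
def twoVar (φ : C(ℤ_[p], ℂ_[p])) (x y : ℤ_[p]) : ℂ_[p] :=
  ∑' k : ℕ, (-1) ^ k * (Nat.factorial k : ℂ_[p]) * zpToCp p (Ring.choose y k) * zpToCp p (Ring.choose x k) *
    φ (x - (k : ℤ_[p]))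

/-- The `p`-adic incomplete Mellin transform, the specialization of `twoVar` at `x = -1`. -/
def mellinPadic (φ : C(ℤ_[p], ℂ_[p])) (y : ℤ_[p]) : ℂ_[p] :=
  twoVar p φ (-1) y

/-- The `p`-adic function `Φ_f`. -/
def PhiPadic (f : PowerSeries ℂ_[p]) : ℤ_[p] → ℂ_[p] :=
  mellinPadic p (phiPadic p f)

/-- `ζ` is a root of unity of order prime to `p`, congruent to `x` modulo the maximal ideal. -/
def IsTeichmuller (x ζ : ℂ_[p]) : Prop :=
  (∃ n : ℕ, 0 < n ∧ n.Coprime p ∧ ζ ^ n = 1) ∧ ‖x - ζ‖ < 1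

/-- The Teichmüller character on the elements of `ℂ_p` of norm `1` (with value `1` elsewhere). -/
def teich (x : ℂ_[p]) : ℂ_[p] :=
  open Classical in if h : ∃ ζ, IsTeichmuller p x ζ then h.choose else 1

/-- `u ^ s = ∑_k (s choose k) (u - 1)^k`, for a principal unit `u` of `ℂ_p` and `s ∈ ℤ_p`. -/
def unitPow (u : ℂ_[p]) (s : ℤ_[p]) : ℂ_[p] :=
  ∑' k : ℕ, zpToCp p (Ring.choose s k) * (u - 1) ^ k

end Padic

/-! ### The complex side -/

/-- `(V, F)` is an analytic continuation, along the half-line `(-∞, 0]`, of the sum of a power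
series `f` of positive radius of convergence. -/
def IsContinuation (f : PowerSeries ℂ) (V : Set ℂ) (F : ℂ → ℂ) : Prop :=
  IsOpen V ∧ IsConnected V ∧ (∀ x : ℝ, x ≤ 0 → (x : ℂ) ∈ V) ∧ AnalyticOnNhd ℂ F V ∧
    ∃ c : ℝ, 0 < c ∧
      ENNReal.ofReal c <
        (FormalMultilinearSeries.ofScalars ℂ (fun n => PowerSeries.coeff n f)).radius ∧
      ∀ x ∈ V, ‖x‖ < c → F x = ∑' n : ℕ, PowerSeries.coeff n f * x ^ n

/-- The function `φ_f = exp ∘ F` on `(-∞, 0]`, where `F` is an analytic continuation of `f` (the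
values of `F` on the half-line do not depend on which one). -/
def phiComplex (f : PowerSeries ℂ) (x : ℝ) : ℂ :=
  open Classical in
  if h : ∃ F : ℂ → ℂ, ∃ V : Set ℂ, IsContinuation f V F then Complex.exp (h.choose x) else 0

/-- The complex incomplete Mellin transform `s ↦ ∫_{-∞}^0 (1 - x)^s φ(x) dx`, where the powers of
the positive number `1 - x` are taken with the real logarithm. -/
def mellinComplex (φ : ℝ → ℂ) (s : ℂ) : ℂ :=
  ∫ x in Set.Iic (0 : ℝ), (((1 - x : ℝ) : ℂ) ^ s) * φ x

/-- The complex function `Φ_f`. -/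
def PhiComplex (f : PowerSeries ℂ) : ℂ → ℂ :=
  mellinComplex (phiComplex f)

/-- The ray `R_θ = {a exp(iθ) : a ≥ 0}`. -/
def ray (θ : ℝ) : Set ℂ :=
  {z | ∃ a : ℝ, 0 ≤ a ∧ z = a * Complex.exp (θ * Complex.I)}

/-- The branch `log_θ` of the logarithm on `ℂ ∖ {0}` with imaginary part in `(θ - 2π, θ]`. -/
def logBranch (θ : ℝ) (w : ℂ) : ℂ :=
  (Real.log ‖w‖ : ℂ) + ((toIocMod Real.two_pi_pos (θ - 2 * Real.pi) w.arg : ℝ) : ℂ) * Complex.I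

theorem exp_logBranch (θ : ℝ) {w : ℂ} (hw : w ≠ 0) : Complex.exp (logBranch θ w) = w := by
  have h : logBranch θ w = Complex.log w -
      ((toIocDiv Real.two_pi_pos (θ - 2 * Real.pi) w.arg : ℤ) : ℂ) * (2 * Real.pi * Complex.I) := by
    rw [logBranch, Complex.log, toIocMod]
    push_cast
    simp only [zsmul_eq_mul]
    ring
  rw [h, Complex.exp_sub, Complex.exp_log hw, Complex.exp_int_mul_two_pi_mul_I, div_one]

theorem logBranch_im_mem (θ : ℝ) (w : ℂ) :
    (logBranch θ w).im ∈ Set.Ioc (θ - 2 * Real.pi) θ := by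
  have h := toIocMod_mem_Ioc Real.two_pi_pos (θ - 2 * Real.pi) w.arg
  simpa [logBranch] using h

/-- The power `w ^ s` of a nonzero complex number, defined via `log_θ`. -/
def powBranch (θ : ℝ) (w s : ℂ) : ℂ :=
  Complex.exp (s * logBranch θ w)

/-- The restriction of `κ` to `[0, ν]` is a contour, i.e. continuous and piecewise `C¹`. -/
def IsContourOn (κ : ℝ → ℂ) (ν : ℝ) : Prop :=
  ∃ (n : ℕ) (t : ℕ → ℝ), Monotone t ∧ t 0 = 0 ∧ t n = ν ∧
    ∀ i < n, ContDiffOn ℝ 1 κ (Set.Icc (t i) (t (i + 1)))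

/-- The infinite contours `κ : [0, ∞) → ℂ` that start at `r`, avoid the ray `R_θ`, and tend to
infinity in a closed sector of the open right half-plane, staying eventually on or below `R_θ` if
that ray lies in the open right half-plane. -/
structure IsAdmissible (θ : ℝ) (r : ℂ) (κ : ℝ → ℂ) : Prop where
  contour : ∀ ν : ℝ, 0 ≤ ν → IsContourOn κ ν
  tendsto : Filter.Tendsto (fun t => ‖κ t‖) Filter.atTop Filter.atTop
  sector : ∃ α₁ ∈ Set.Ioo (-(Real.pi / 2)) (Real.pi / 2),
    ∃ α₂ ∈ Set.Ioo (-(Real.pi / 2)) (Real.pi / 2), ∃ t₀ : ℝ, 0 ≤ t₀ ∧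
      ∀ t ≥ t₀, 0 < (κ t).re ∧ α₁ ≤ (κ t).arg ∧ (κ t).arg ≤ α₂
  avoids : ∀ t : ℝ, 0 ≤ t → κ t ∉ ray θ
  below : 0 < Real.cos θ → ∃ t₁ : ℝ, 0 ≤ t₁ ∧
    ∀ t ≥ t₁, (κ t).im * Real.cos θ ≤ (κ t).re * Real.sin θ
  start : κ 0 = r

/-- The integral of `u^(s - 1) exp(-u)` over `κ`, as the limit of the integrals over `κ|_[0, N]`. -/
def upperGammaAlong (θ : ℝ) (κ : ℝ → ℂ) (s : ℂ) : ℂ :=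
  Filter.limUnder Filter.atTop fun N : ℕ =>
    ∫ t in (0 : ℝ)..N, powBranch θ (κ t) (s - 1) * Complex.exp (-κ t) * deriv κ t

/-- The upper incomplete gamma-function `Γ^θ(s, r)`, computed along any admissible contour. -/
def upperGamma (θ : ℝ) (s r : ℂ) : ℂ :=
  open Classical in
  if h : ∃ κ, IsAdmissible θ r κ then upperGammaAlong θ h.choose s else 0

/-- The lower incomplete gamma-function `γ^θ(s, r)`, for `Re s > 0`. -/
def lowerGamma (θ : ℝ) (s r : ℂ) : ℂ :=
  Filter.limUnder Filter.atTop fun N : ℕ =>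
    ∫ t in (1 / N : ℝ)..1, powBranch θ (t * r) (s - 1) * Complex.exp (-(t * r)) * r

/-- `Γ^θ(s, r) + γ^θ(s, r)`. -/
def gammaHat (θ : ℝ) (r s : ℂ) : ℂ :=
  upperGamma θ s r + lowerGamma θ s r

/-! ### Both sides together -/

/-- `⟨x⟩_P`: the principal unit `x / teich x` at a finite place, and `x` at the infinite place. -/
def princ : (P : RatPlace) → P.Omega → P.Omega
  | .infinite => fun x => x
  | @RatPlace.finite p _ => fun x : ℂ_[p] => (x / teich p x : ℂ_[p])

/-- The power `⟨x⟩_P ^ s`, where complex powers are taken with the branch `log_θ`. -/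
def princPow (θ : ℝ) : (P : RatPlace) → P.Omega → P.Post → P.Omega
  | .infinite => fun x s => powBranch θ (princ .infinite x) s
  | @RatPlace.finite p _ => fun x s => unitPow p (princ (RatPlace.finite p) x) s

/-- `Φ_{f, P}` for a power series `f` over `ℚ`. -/
def Phi (f : PowerSeries ℚ) : (P : RatPlace) → P.Post → P.Omega
  | .infinite => PhiComplex (f.map (algebraMap ℚ ℂ))
  | @RatPlace.finite p _ => PhiPadic p (f.map (algebraMap ℚ ℂ_[p]))

/-- The image of `1 / r` in the domain `P.Post`, for `P ∉ P_r`. -/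
def invPost (r : ℚ) : (P : RatPlace) → P.Post
  | .infinite => ((1 / r : ℚ) : ℂ)
  | @RatPlace.finite p _ => ratToZp p (1 / r)

/-- The correction term of `Ψ_{r, P}`: it is `exp(r) Γ̂(s + 1)` in the exceptional case, where `P`
is archimedean and `r < 0`, and it is `0` in the ordinary case. -/
def correction (θ : ℝ) (r : ℚ) : (P : RatPlace) → P.Post → P.Omega
  | .infinite => fun s : ℂ =>
      if r < 0 then Complex.exp (r : ℂ) * gammaHat θ (r : ℂ) (s + 1) else (0 : ℂ)
  | @RatPlace.finite _ _ => fun _ => 0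

/-- `Ψ_{r, P}(s) = ⟨r⟩_P^s Φ_{f_r, P}((s + 1) / r - 1)`, plus `exp(r) Γ̂(s + 1)` in the exceptional
case (where only `Re s > -1` is meaningful). -/
def Psi (θ : ℝ) (r : ℚ) (P : RatPlace) (s : P.Post) : P.Omega :=
  princPow θ P (r : P.Omega) s * Phi (fSeries r) P (invPost r P * (s + 1) - 1) +
    correction θ r P s

end IncGamma

end

noncomputable section

namespace IncGamma

open PowerSeries

/-! ### The power series `(1 - t) ^ y` and `exp ∘ f` -/

section Series

variable {K : Type*} [Field K] [CharZero K]

/-! At every place `Φ` is an incomplete Mellin transform of `exp(f_r)`, and everything rests on one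
identity. Since `f_r' = (1 - t)^(1/r - 1)`, the derivative of `(1 - t)^(y + 1) exp(f_r)` is `-(y +
1) (1 - t)^y exp(f_r) + (1 - t)^(y + 1/r) exp(f_r)` (`derivative_oneSubPow_mul_expComp`).
Integration by parts turns this into `Φ(y + 1/r) = 1 + (y + 1) Φ(y)`, the `1` being the boundary
value at `t = 0`. Starting from `y = -1` and moving in steps of `1/r`, one gets the recursion of
`psiTilde`.

At a finite place the identity is compared coefficientwise at `x = n`, extended to `x ∈ ℤ_p` by
density, and evaluated at `x = -1` (`twoVar_phiPadic_succ`, `PhiPadic_fSeries`). At the infinite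
place `u = 1 - x` gives an integral over `[1, ∞)`. For `r > 0` nothing comes from infinity
(`weightIntegral_of_pos`). For `r < 0` the weight tends to `exp(r)`, and the integral falls short by
`exp(r) m! / r^m` (`weightIntegral_of_neg`). The correction term makes up for this, because `Γ̂(m +
1) = m!` (`gammaHat_natCast_add_one`): at integers the integrand is entire, so neither branch nor
contour matters.

Part (ii) follows because the Teichmüller representative of `r` is killed by `p - 1` (`teich_pow`),
so `⟨r⟩^m = r^m` when `p - 1 ∣ m`. -/

/-- The binomial series `(1 - t) ^ y`. -/
def oneSubPow (y : K) : PowerSeries K :=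
  PowerSeries.mk fun k => (-1) ^ k * Ring.choose y k

theorem coeff_oneSubPow (y : K) (k : ℕ) :
    coeff k (oneSubPow y) = (-1) ^ k * Ring.choose y k := by
  simp [oneSubPow]

theorem oneSubPow_eq_rescale (y : K) :
    oneSubPow y = rescale (-1 : K) (PowerSeries.binomialSeries K y) := by
  ext k
  simp [coeff_oneSubPow, coeff_rescale, binomialSeries_coeff]

theorem oneSubPow_add (y z : K) : oneSubPow (y + z) = oneSubPow y * oneSubPow z := by
  simp only [oneSubPow_eq_rescale, binomialSeries_add, map_mul]

theorem succ_mul_choose_succ (y : K) (k : ℕ) :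
    ((k : K) + 1) * Ring.choose y (k + 1) = y * Ring.choose (y - 1) k := by
  have h0 : ((k.factorial : ℕ) : K) ≠ 0 := Nat.cast_ne_zero.mpr k.factorial_ne_zero
  have h1 := Ring.descPochhammer_eq_factorial_smul_choose y (k + 1)
  have h2 := Ring.descPochhammer_eq_factorial_smul_choose (y - 1) k
  have h3 := Ring.descPochhammer_succ_succ_smeval (y - 1) k
  have h4 : (descPochhammer ℤ (k + 1)).smeval y = y * (descPochhammer ℤ k).smeval (y - 1) := by
    rw [descPochhammer_succ_left, Polynomial.smeval_X_mul, Polynomial.smeval_comp]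
    simp [Polynomial.smeval_sub]
  rw [h1, h2, Nat.factorial_succ, nsmul_eq_mul, nsmul_eq_mul] at h4
  push_cast at h4
  apply mul_left_cancel₀ h0
  linear_combination h4

theorem derivative_oneSubPow (y : K) :
    derivative K (oneSubPow (y + 1)) = -C (y + 1) * oneSubPow y := by
  ext k
  have h := succ_mul_choose_succ (y + 1) k
  rw [add_sub_cancel_right] at h
  rw [coeff_derivative, coeff_oneSubPow, neg_mul, map_neg, coeff_C_mul, coeff_oneSubPow, pow_succ]
  linear_combination (-(-1) ^ k) * h

theorem constantCoeff_fSeries_map (r : ℚ) :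
    constantCoeff ((fSeries r).map (algebraMap ℚ K)) = 0 := by
  rw [← coeff_zero_eq_constantCoeff_apply, coeff_map]
  simp [fSeries]

theorem fSeries_map_eq (r : ℚ) :
    (fSeries r).map (algebraMap ℚ K) = C (-(r : K)) * (oneSubPow (1 / (r : K)) - 1) := by
  ext k
  rw [coeff_map, coeff_C_mul, map_sub, coeff_oneSubPow]
  simp only [fSeries, coeff_mk]
  by_cases hk : k = 0
  · simp [hk]
  · have : algebraMap ℚ K (Ring.choose (1 / r) k) = Ring.choose (1 / (r : K)) k := by
      rw [Ring.map_choose (algebraMap ℚ K)]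
      simp
    rw [if_neg hk, map_mul, map_mul, this]
    simp [coeff_one, hk]

theorem derivative_fSeries_map {r : ℚ} (hr : r ≠ 0) :
    derivative K ((fSeries r).map (algebraMap ℚ K)) = oneSubPow (1 / (r : K) - 1) := by
  have hr' : (r : K) ≠ 0 := Rat.cast_ne_zero.mpr hr
  have h := derivative_oneSubPow (1 / (r : K) - 1)
  rw [sub_add_cancel] at h
  rw [fSeries_map_eq, Derivation.leibniz, derivative_C, smul_zero, add_zero, map_sub, h]
  simp only [Derivation.map_one_eq_zero, sub_zero, smul_eq_mul, neg_mul, mul_neg, ← mul_assoc,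
    ← map_mul, map_neg, neg_neg]
  rw [mul_one_div_cancel hr', map_one, one_mul]

/-! ### Exponentials of power series and their differential equations. -/

/-- `exp ∘ f`, for `f` without constant term. -/
def expComp (f : PowerSeries K) : PowerSeries K := (PowerSeries.exp K).subst f

theorem derivative_expComp {f : PowerSeries K} (hf : constantCoeff f = 0) :
    derivative K (expComp f) = expComp f * derivative K f := by
  rw [expComp, derivative_subst (HasSubst.of_constantCoeff_zero' hf), derivative_exp]

/-- Without constant term, `f ^ d` has order at least `d`, so only `d ≤ n` contributes. -/
theorem coeff_expComp {f : PowerSeries K} (hf : constantCoeff f = 0) (n : ℕ) :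
    coeff n (expComp f) = ∑ d ∈ Finset.range (n + 1), (d.factorial : K)⁻¹ * coeff n (f ^ d) := by
  rw [expComp, coeff_subst' (HasSubst.of_constantCoeff_zero' hf)]
  rw [finsum_eq_sum_of_support_subset (s := Finset.range (n + 1))]
  · simp [coeff_exp]
  · intro d hd
    simp only [Finset.coe_range, Set.mem_Iio]
    by_contra! h
    apply hd
    have : coeff n (f ^ d) = 0 := by
      apply coeff_of_lt_order
      refine lt_of_lt_of_le (b := (d : ℕ∞)) (by exact_mod_cast h) ?_
      refine le_trans ?_ (le_order_pow _ _)
      have := one_le_order_iff_constCoeff_eq_zero.mpr hf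
      calc (d : ℕ∞) = d • (1 : ℕ∞) := by simp
        _ ≤ d • f.order := nsmul_le_nsmul_right this d
    simp [this]

theorem constantCoeff_expComp {f : PowerSeries K} (hf : constantCoeff f = 0) :
    constantCoeff (expComp f) = 1 := by
  rw [← coeff_zero_eq_constantCoeff_apply, coeff_expComp hf]
  simp

/-- A power series is determined by its constant term and its logarithmic derivative. -/
theorem eq_of_derivative_eq_mul {A B g : PowerSeries K} (hA : derivative K A = A * g)
    (hB : derivative K B = B * g) (h0 : constantCoeff A = constantCoeff B) : A = B := by
  suffices ∀ n, ∀ m ≤ n, coeff m A = coeff m B by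
    ext n
    exact this n n le_rfl
  intro n
  induction n with
  | zero =>
    intro m hm
    obtain rfl : m = 0 := by omega
    simpa using h0
  | succ n ih =>
    intro m hm
    rcases Nat.lt_or_ge m (n + 1) with h | h
    · exact ih m (by omega)
    obtain rfl : m = n + 1 := by omega
    have hn : (n : K) + 1 ≠ 0 := Nat.cast_add_one_ne_zero n
    apply mul_right_cancel₀ hn
    rw [← coeff_derivative, ← coeff_derivative, hA, hB, coeff_mul, coeff_mul]
    refine Finset.sum_congr rfl fun i hi => ?_
    rw [ih i.1 (by have := Finset.HasAntidiagonal.mem_antidiagonal.1 hi; omega)]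

/-- Splitting off `exp(t)` exhibits the numbers `n! * coeff n (expComp f)` as a binomial transform
of those of `f - X`; the latter are thus the Mahler coefficients of the interpolating function. -/
theorem expComp_eq_exp_mul {f : PowerSeries K} (hf : constantCoeff f = 0) :
    expComp f = PowerSeries.exp K * expComp (f - X) := by
  have hf' : constantCoeff (f - X) = 0 := by simp [hf]
  refine eq_of_derivative_eq_mul (g := derivative K f) (derivative_expComp hf) ?_ ?_
  · rw [Derivation.leibniz, derivative_exp, derivative_expComp hf', map_sub, derivative_X]
    simp only [smul_eq_mul]
    ring
  · simp [constantCoeff_expComp hf, constantCoeff_expComp hf']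

/-- The differential equation of `(1 - t) ^ (y + 1) exp (f_r(t))`. -/
theorem derivative_oneSubPow_mul_expComp {r : ℚ} (hr : r ≠ 0) (y : K) :
    derivative K (oneSubPow (y + 1) * expComp ((fSeries r).map (algebraMap ℚ K))) =
      -C (y + 1) * (oneSubPow y * expComp ((fSeries r).map (algebraMap ℚ K))) +
        oneSubPow (y + 1 / (r : K)) * expComp ((fSeries r).map (algebraMap ℚ K)) := by
  rw [Derivation.leibniz, derivative_oneSubPow, derivative_expComp (constantCoeff_fSeries_map r),
    derivative_fSeries_map hr, show y + 1 / (r : K) = (y + 1) + (1 / (r : K) - 1) by ring,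
    oneSubPow_add (y + 1)]
  simp only [smul_eq_mul]
  ring

end Series

end IncGamma

end

noncomputable section

namespace IncGamma

open PowerSeries

/-! ### The `p`-adic places -/

/-- The sequence `Ψ̃` of the values at natural numbers. -/
def psiTilde (r : ℚ) : ℕ → ℚ
  | 0 => 1
  | m + 1 => 1 + ((m : ℚ) + 1) / r * psiTilde r m

/-- Sorting `n` by its remainder modulo `q` gives `q` copies of a geometric series. This is the
majorant for all the `p`-adic series below. -/
theorem summable_half_pow_div {q : ℕ} (hq : 0 < q) :
    Summable fun n : ℕ => (1 / 2 : ℝ) ^ (n / q) := by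
  have : NeZero q := ⟨hq.ne'⟩
  rw [← (Nat.divModEquiv q).symm.summable_iff]
  have h := (summable_geometric_two).mul_of_nonneg
    (Summable.of_finite (f := fun _ : Fin q => (1 : ℝ))) (fun _ => by positivity)
    (fun _ => by positivity)
  refine h.congr fun x => ?_
  have : ((Nat.divModEquiv q).symm x) / q = x.1 := by
    rw [Nat.divModEquiv_symm_apply, add_comm, mul_comm, Nat.add_mul_div_left _ _ hq,
      Nat.div_eq_of_lt x.2.isLt, zero_add]
  simp only [Function.comp_apply, this, mul_one]

section Padic

variable (p : ℕ) [Fact p.Prime]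

/-! ### Norm estimates in `ℂ_[p]`. -/

theorem norm_zpToCp (z : ℤ_[p]) : ‖zpToCp p z‖ = ‖z‖ := by
  simp only [zpToCp, RingHom.comp_apply, norm_algebraMap']
  rfl

theorem norm_zpToCp_le_one (z : ℤ_[p]) : ‖zpToCp p z‖ ≤ 1 :=
  (norm_zpToCp p z).trans_le z.norm_le_one

theorem continuous_zpToCp : Continuous (zpToCp p) :=
  (AddMonoidHomClass.isometry_of_norm (zpToCp p) (norm_zpToCp p)).continuous

theorem zpToCp_choose (z : ℤ_[p]) (k : ℕ) :
    zpToCp p (Ring.choose z k) = Ring.choose (zpToCp p z) k :=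
  Ring.map_choose (zpToCp p) z k

theorem norm_ratCast_padicComplex (q : ℚ) : ‖(q : ℂ_[p])‖ = ‖(q : ℚ_[p])‖ := by
  rw [← norm_algebraMap' ℂ_[p] (q : ℚ_[p]), map_ratCast]

theorem norm_natCast_padicComplex (n : ℕ) : ‖(n : ℂ_[p])‖ = ‖(n : ℚ_[p])‖ := by
  exact_mod_cast norm_ratCast_padicComplex p n

theorem norm_natCast_le_one (n : ℕ) : ‖(n : ℂ_[p])‖ ≤ 1 :=
  IsUltrametricDist.norm_natCast_le_one ℂ_[p] n

theorem norm_natCast_le_of_dvd {m n : ℕ} (h : m ∣ n) : ‖(n : ℂ_[p])‖ ≤ ‖(m : ℂ_[p])‖ := by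
  obtain ⟨k, rfl⟩ := h
  rw [Nat.cast_mul, norm_mul]
  exact mul_le_of_le_one_right (norm_nonneg _) (norm_natCast_le_one p k)

/-- `p ^ (n / p)` divides `n!`, and `1 / p ≤ 1 / 2`. -/
theorem norm_factorial_le (n : ℕ) : ‖((n.factorial : ℕ) : ℂ_[p])‖ ≤ (1 / 2) ^ (n / p) := by
  have hp : p.Prime := Fact.out
  have hdvd : ∀ j : ℕ, p ^ j ∣ (p * j).factorial := by
    intro j
    induction j with
    | zero => simp
    | succ j ih =>
      rw [pow_succ, mul_add, mul_one]
      exact (mul_dvd_mul ih (Nat.dvd_factorial hp.pos le_rfl)).trans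
        (Nat.factorial_mul_factorial_dvd_factorial_add _ _)
  have h : p ^ (n / p) ∣ n.factorial :=
    (hdvd _).trans (Nat.factorial_dvd_factorial (Nat.mul_div_le n p))
  refine (norm_natCast_le_of_dvd p h).trans ?_
  rw [Nat.cast_pow, norm_pow, norm_natCast_padicComplex, Padic.norm_p]
  have h2 : (2 : ℝ) ≤ p := by exact_mod_cast hp.two_le
  rw [one_div]
  gcongr

/-- A `p`-adic power series with integral coefficients. -/
def IsIntegral (g : PowerSeries ℂ_[p]) : Prop := ∀ n, ‖coeff n g‖ ≤ 1

variable {p}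

theorem IsIntegral.mul {f g : PowerSeries ℂ_[p]} (hf : IsIntegral p f) (hg : IsIntegral p g) :
    IsIntegral p (f * g) := by
  intro n
  rw [coeff_mul]
  refine IsUltrametricDist.norm_sum_le_of_forall_le_of_nonneg zero_le_one fun i _ => ?_
  rw [norm_mul]
  exact mul_le_one₀ (hf _) (norm_nonneg _) (hg _)

theorem IsIntegral.pow {g : PowerSeries ℂ_[p]} (hg : IsIntegral p g) (d : ℕ) :
    IsIntegral p (g ^ d) := by
  induction d with
  | zero =>
    intro n
    rw [pow_zero, coeff_one]
    split_ifs <;> simp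
  | succ d ih =>
    rw [pow_succ]
    exact ih.mul hg

/-- The `d`-th term vanishes unless `2 * d ≤ n`. In that case `n! / d!` is an integer multiple of
`(n - d)!` with `n - d ≥ n / 2`, which is small. -/
theorem norm_factorial_mul_coeff_expComp_le {g : PowerSeries ℂ_[p]} (hg : IsIntegral p g)
    (hX : X ^ 2 ∣ g) (n : ℕ) :
    ‖(n.factorial : ℂ_[p]) * coeff n (expComp g)‖ ≤ (1 / 2) ^ (n / (2 * p)) := by
  have h0 : constantCoeff g = 0 := by
    rw [← coeff_zero_eq_constantCoeff_apply]
    exact X_pow_dvd_iff.mp hX 0 two_pos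
  rw [coeff_expComp h0, Finset.mul_sum]
  refine IsUltrametricDist.norm_sum_le_of_forall_le_of_nonneg (by positivity) fun d hd => ?_
  rcases Nat.lt_or_ge n (2 * d) with h | h
  · have : coeff n (g ^ d) = 0 := by
      have hd : X ^ (2 * d) ∣ g ^ d := by
        rw [pow_mul]
        exact pow_dvd_pow_of_dvd hX d
      exact X_pow_dvd_iff.mp hd n h
    rw [this, mul_zero, mul_zero, norm_zero]
    positivity
  · have hd0 : (d.factorial : ℂ_[p]) ≠ 0 := Nat.cast_ne_zero.mpr d.factorial_ne_zero
    have h1 : (n.factorial : ℂ_[p]) * (d.factorial : ℂ_[p])⁻¹ =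
        (n.choose d : ℂ_[p]) * ((n - d).factorial : ℂ_[p]) := by
      rw [← div_eq_mul_inv, div_eq_iff hd0, ← Nat.choose_mul_factorial_mul_factorial (n := n)
        (k := d) (by omega)]
      push_cast
      ring
    rw [← mul_assoc, h1, norm_mul, norm_mul]
    calc ‖(n.choose d : ℂ_[p])‖ * ‖((n - d).factorial : ℂ_[p])‖ * ‖coeff n (g ^ d)‖
        ≤ 1 * (1 / 2) ^ ((n - d) / p) * 1 := by
          gcongr
          · exact norm_natCast_le_one p _
          · exact norm_factorial_le p _
          · exact hg.pow d n
      _ = (1 / 2) ^ ((n - d) / p) := by ring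
      _ ≤ (1 / 2) ^ (n / (2 * p)) := by
          refine pow_le_pow_of_le_one (by norm_num) (by norm_num) ?_
          rw [← Nat.div_div_eq_div_mul]
          exact Nat.div_le_div_right (by omega)

/-! ### Interpolation of `exp ∘ f` by Mahler series. -/

/-- The Mahler series with coefficients `b`, if these are summable. -/
theorem exists_continuous_mahler {b : ℕ → ℂ_[p]} {u : ℕ → ℝ} (hu : Summable u)
    (hb : ∀ n, ‖b n‖ ≤ u n) :
    ∃ φ : C(ℤ_[p], ℂ_[p]), ∀ n : ℕ,
      φ n = ∑ k ∈ Finset.range (n + 1), (n.choose k : ℂ_[p]) * b k := by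
  refine ⟨⟨fun x => ∑' k : ℕ, zpToCp p (Ring.choose x k) * b k, ?_⟩, fun n => ?_⟩
  · refine continuous_tsum (fun k => ?_) hu fun k x => ?_
    · exact ((continuous_zpToCp p).comp (PadicInt.continuous_choose k)).mul continuous_const
    · rw [norm_mul]
      exact (mul_le_of_le_one_left (norm_nonneg _) (norm_zpToCp_le_one p _)).trans (hb k)
  · simp only [ContinuousMap.coe_mk, Ring.choose_natCast, map_natCast]
    refine tsum_eq_sum fun k hk => ?_
    rw [Nat.choose_eq_zero_of_lt (by simpa using hk), Nat.cast_zero, zero_mul]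

/-- Linear coefficient `1` is what makes `X ^ 2` divide `f - X`, so that the Mahler coefficients
decay. -/
theorem exists_continuous_interpolation {f : PowerSeries ℂ_[p]} (hf : IsIntegral p f)
    (h0 : coeff 0 f = 0) (h1 : coeff 1 f = 1) :
    ∃ φ : C(ℤ_[p], ℂ_[p]), ∀ n : ℕ, φ n = (n.factorial : ℂ_[p]) * coeff n (expComp f) := by
  have hX : X ^ 2 ∣ f - X := by
    refine X_pow_dvd_iff.mpr fun m hm => ?_
    interval_cases m
    · simpa using h0
    · simp [h1]
  have hg : IsIntegral p (f - X) := by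
    intro n
    rw [map_sub, coeff_X]
    split_ifs with h
    · simp [h, h1]
    · simpa using hf n
  have hp : 0 < 2 * p := Nat.mul_pos two_pos (Fact.out : p.Prime).pos
  obtain ⟨φ, hφ⟩ := exists_continuous_mahler (summable_half_pow_div hp)
    (norm_factorial_mul_coeff_expComp_le hg hX)
  refine ⟨φ, fun n => ?_⟩
  have hc : constantCoeff f = 0 := by simpa using h0
  rw [hφ, expComp_eq_exp_mul hc, mul_comm (PowerSeries.exp ℂ_[p]), coeff_mul,
    Finset.Nat.sum_antidiagonal_eq_sum_range_succ_mk, Finset.mul_sum]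
  refine Finset.sum_congr rfl fun k hk => ?_
  have hkn : k ≤ n := by simpa [Nat.lt_succ_iff] using hk
  have hne : ((n - k).factorial : ℂ_[p]) ≠ 0 := Nat.cast_ne_zero.mpr (Nat.factorial_ne_zero _)
  rw [← Nat.choose_mul_factorial_mul_factorial hkn, coeff_exp]
  push_cast
  simp only [one_div]
  field_simp

theorem gexp_eq_expComp {f : PowerSeries ℂ_[p]} (hc : constantCoeff f = 0) :
    gexp p f = expComp f := by
  simp [gexp, hc, expComp]

/-- The defining equation prescribes every value at a natural number, so existence suffices and the
choice in `phiPadic` is harmless. -/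
theorem phiPadic_natCast {f : PowerSeries ℂ_[p]} (hf : IsIntegral p f)
    (h0 : coeff 0 f = 0) (h1 : coeff 1 f = 1) (n : ℕ) :
    phiPadic p f n = (n.factorial : ℂ_[p]) * coeff n (expComp f) := by
  have hc : constantCoeff f = 0 := by simpa using h0
  have hne : ∀ n : ℕ, (n.factorial : ℂ_[p]) ≠ 0 :=
    fun n => Nat.cast_ne_zero.mpr (Nat.factorial_ne_zero n)
  have h : ∃ φ : C(ℤ_[p], ℂ_[p]),
      PowerSeries.mk (fun n : ℕ => φ (n : ℤ_[p]) / (Nat.factorial n : ℂ_[p])) = gexp p f := by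
    obtain ⟨φ, hφ⟩ := exists_continuous_interpolation hf h0 h1
    refine ⟨φ, ?_⟩
    ext n
    rw [coeff_mk, hφ, gexp_eq_expComp hc, mul_div_cancel_left₀ _ (hne n)]
  have hs := congrArg (coeff n) h.choose_spec
  rw [coeff_mk, div_eq_iff (hne n), mul_comm] at hs
  rw [phiPadic, dif_pos h, ← gexp_eq_expComp hc]
  exact hs

/-- At `x = n` the series is finite, and `k! * (n choose k) * (n - k)! = n!` makes it a Cauchy
product. -/
theorem twoVar_natCast {φ : C(ℤ_[p], ℂ_[p])} {H : PowerSeries ℂ_[p]}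
    (hφ : ∀ n : ℕ, φ n = (n.factorial : ℂ_[p]) * coeff n H) (y : ℤ_[p]) (n : ℕ) :
    twoVar p φ n y = (n.factorial : ℂ_[p]) * coeff n (oneSubPow (zpToCp p y) * H) := by
  rw [twoVar, tsum_eq_sum (s := Finset.range (n + 1)), coeff_mul,
    Finset.Nat.sum_antidiagonal_eq_sum_range_succ_mk, Finset.mul_sum]
  · refine Finset.sum_congr rfl fun k hk => ?_
    have hkn : k ≤ n := by simpa [Nat.lt_succ_iff] using hk
    rw [← Nat.cast_sub hkn, hφ, coeff_oneSubPow, zpToCp_choose, Ring.choose_natCast, map_natCast,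
      ← Nat.choose_mul_factorial_mul_factorial hkn]
    push_cast
    ring
  · intro k hk
    rw [Ring.choose_natCast, Nat.choose_eq_zero_of_lt (by simpa using hk)]
    simp

/-- The factor `k!` gives a summable bound uniform in `x`; the binomial coefficients lie in `ℤ_p`.
-/
theorem continuous_twoVar (φ : C(ℤ_[p], ℂ_[p])) (y : ℤ_[p]) :
    Continuous fun x => twoVar p φ x y := by
  have hp : 0 < p := (Fact.out : p.Prime).pos
  refine continuous_tsum (u := fun k => (1 / 2) ^ (k / p) * ‖φ‖) (fun k => ?_)
    ((summable_half_pow_div hp).mul_right _) fun k x => ?_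
  · refine (continuous_const.mul ?_).mul (φ.continuous.comp (continuous_id.sub continuous_const))
    exact (continuous_zpToCp p).comp (PadicInt.continuous_choose k)
  · simp only [norm_mul, norm_pow, norm_neg, norm_one, one_pow, one_mul]
    refine mul_le_mul ?_ (φ.norm_coe_le_norm _) (norm_nonneg _) (by positivity)
    calc _ ≤ ‖(k.factorial : ℂ_[p])‖ * 1 * 1 := by
          gcongr <;> exact norm_zpToCp_le_one p _
      _ ≤ _ := by simpa using norm_factorial_le p k

/-! ### The recursion for `Φ` at a finite place; `w` is `1 / r` as a `p`-adic integer. -/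

variable {r : ℚ} {w : ℤ_[p]}

theorem isIntegral_fSeries_map (hn : ‖(r : ℚ_[p])‖ ≤ 1) (hw : zpToCp p w = 1 / (r : ℂ_[p])) :
    IsIntegral p ((fSeries r).map (algebraMap ℚ ℂ_[p])) := by
  intro n
  rw [fSeries_map_eq, coeff_C_mul, map_sub, coeff_oneSubPow, ← hw, ← zpToCp_choose, norm_mul,
    norm_neg, norm_ratCast_padicComplex]
  refine mul_le_one₀ hn (norm_nonneg _) ?_
  rw [sub_eq_add_neg]
  refine (IsUltrametricDist.norm_add_le_max _ _).trans (max_le ?_ ?_)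
  · simpa using norm_zpToCp_le_one p _
  · rw [norm_neg, coeff_one]
    split_ifs <;> simp

theorem twoVar_phiPadic_natCast (hr : r ≠ 0) (hn : ‖(r : ℚ_[p])‖ ≤ 1)
    (hw : zpToCp p w = 1 / (r : ℂ_[p])) (y : ℤ_[p]) (n : ℕ) :
    twoVar p (phiPadic p ((fSeries r).map (algebraMap ℚ ℂ_[p]))) n y = (n.factorial : ℂ_[p]) *
      coeff n (oneSubPow (zpToCp p y) * expComp ((fSeries r).map (algebraMap ℚ ℂ_[p]))) := by
  have hr' : (r : ℂ_[p]) ≠ 0 := Rat.cast_ne_zero.mpr hr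
  refine twoVar_natCast (phiPadic_natCast (isIntegral_fSeries_map hn hw) ?_ ?_) y n
  · rw [coeff_zero_eq_constantCoeff_apply, constantCoeff_fSeries_map]
  · rw [fSeries_map_eq, coeff_C_mul, map_sub, coeff_oneSubPow, Ring.choose_one_right, coeff_one]
    simp [hr']

/-- Integration by parts for the two-variable transform. -/
theorem twoVar_phiPadic_succ (hr : r ≠ 0) (hn : ‖(r : ℚ_[p])‖ ≤ 1)
    (hw : zpToCp p w = 1 / (r : ℂ_[p])) (x y : ℤ_[p]) :
    twoVar p (phiPadic p ((fSeries r).map (algebraMap ℚ ℂ_[p]))) (x + 1) (y + 1) =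
      -zpToCp p (y + 1) * twoVar p (phiPadic p ((fSeries r).map (algebraMap ℚ ℂ_[p]))) x y +
        twoVar p (phiPadic p ((fSeries r).map (algebraMap ℚ ℂ_[p]))) x (y + w) := by
  -- Both sides are continuous in `x`, so it suffices to treat `x = n`. There the claim is `n!`
  -- times the `n`-th coefficient of the differential equation; the factor `n + 1` from the
  -- derivative completes `(n + 1)!` and accounts for `x + 1`.
  revert x
  refine congrFun (PadicInt.denseRange_natCast.equalizer ?_ ?_ (funext fun n => ?_))
  · exact (continuous_twoVar _ _).comp (continuous_id.add continuous_const)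
  · exact (continuous_const.mul (continuous_twoVar _ _)).add (continuous_twoVar _ _)
  have h := congrArg (coeff n) (derivative_oneSubPow_mul_expComp hr (zpToCp p y))
  rw [coeff_derivative, map_add, neg_mul, map_neg, coeff_C_mul] at h
  have e : (n : ℤ_[p]) + 1 = ((n + 1 : ℕ) : ℤ_[p]) := by push_cast; rfl
  simp only [Function.comp_apply]
  rw [e]
  simp only [twoVar_phiPadic_natCast hr hn hw, map_add, map_one, hw, Nat.factorial_succ]
  push_cast
  linear_combination (n.factorial : ℂ_[p]) * h

/-- At `x = -1` the left side of `twoVar_phiPadic_succ` sits at `x + 1 = 0`, where it is a constant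
coefficient, namely `1`. -/
theorem mellinPadic_phiPadic_add (hr : r ≠ 0) (hn : ‖(r : ℚ_[p])‖ ≤ 1)
    (hw : zpToCp p w = 1 / (r : ℂ_[p])) (y : ℤ_[p]) :
    PhiPadic p ((fSeries r).map (algebraMap ℚ ℂ_[p])) (y + w) =
      1 + zpToCp p (y + 1) * PhiPadic p ((fSeries r).map (algebraMap ℚ ℂ_[p])) y := by
  have h := twoVar_phiPadic_succ hr hn hw (-1) y
  have h0 := twoVar_phiPadic_natCast hr hn hw (y + 1) 0
  have hc := constantCoeff_expComp (constantCoeff_fSeries_map (K := ℂ_[p]) r)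
  have hb : constantCoeff (oneSubPow (zpToCp p (y + 1))) = 1 := by
    rw [← coeff_zero_eq_constantCoeff_apply, coeff_oneSubPow]
    simp
  rw [coeff_zero_eq_constantCoeff_apply, map_mul, hb, hc] at h0
  simp only [Nat.cast_zero, Nat.factorial_zero, Nat.cast_one, mul_one] at h0
  rw [neg_add_cancel, h0] at h
  simp only [PhiPadic, mellinPadic]
  linear_combination -h

theorem PhiPadic_fSeries (hr : r ≠ 0) (hn : ‖(r : ℚ_[p])‖ ≤ 1)
    (hw : zpToCp p w = 1 / (r : ℂ_[p])) (m : ℕ) :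
    PhiPadic p ((fSeries r).map (algebraMap ℚ ℂ_[p])) (w * (m + 1) - 1) = (psiTilde r m : ℚ) := by
  induction m with
  | zero =>
    -- At `y = -1` the factor `y + 1` vanishes, so the recursion needs no initial value.
    have h := mellinPadic_phiPadic_add hr hn hw (-1)
    rw [neg_add_cancel, map_zero, zero_mul, add_zero] at h
    rw [show w * (((0 : ℕ) : ℤ_[p]) + 1) - 1 = -1 + w by push_cast; ring, h]
    simp [psiTilde]
  | succ m ih =>
    have h := mellinPadic_phiPadic_add hr hn hw (w * (m + 1) - 1)
    rw [ih, sub_add_cancel, map_mul, hw, map_add, map_natCast, map_one] at h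
    rw [show w * (((m + 1 : ℕ) : ℤ_[p]) + 1) - 1 = w * (m + 1) - 1 + w by push_cast; ring, h]
    simp only [psiTilde]
    push_cast
    ring

/-! ### Principal units and the Teichmüller character. -/

theorem norm_ratCast_eq_one (hr : r ≠ 0) (hv : padicValRat p r = 0) : ‖(r : ℚ_[p])‖ = 1 := by
  rw [Padic.eq_padicNorm, padicNorm.eq_zpow_of_nonzero hr, hv]
  simp

theorem zpToCp_ratToZp {q : ℚ} (hq : ‖(q : ℚ_[p])‖ ≤ 1) : zpToCp p (ratToZp p q) = (q : ℂ_[p]) := by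
  have h : ratToZp p q = ⟨(q : ℚ_[p]), hq⟩ := dif_pos hq
  rw [h]
  exact map_ratCast (algebraMap ℚ_[p] ℂ_[p]) q

theorem unitPow_natCast (u : ℂ_[p]) (m : ℕ) : unitPow p u m = u ^ m := by
  rw [unitPow, tsum_eq_sum (s := Finset.range (m + 1))]
  · conv_rhs => rw [← sub_add_cancel u 1, add_pow]
    refine Finset.sum_congr rfl fun k _ => ?_
    rw [Ring.choose_natCast, map_natCast, one_pow, mul_one, mul_comm]
  · intro k hk
    rw [Ring.choose_natCast, Nat.choose_eq_zero_of_lt (by simpa using hk)]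
    simp

theorem teich_ne_zero (x : ℂ_[p]) : teich p x ≠ 0 := by
  rw [teich]
  split_ifs with h
  · obtain ⟨⟨n, hn, -, h1⟩, -⟩ := h.choose_spec
    intro h0
    rw [h0, zero_pow hn.ne'] at h1
    exact zero_ne_one h1
  · exact one_ne_zero

/-- A root of unity of order prime to `p` which is congruent to `1` is `1`. -/
theorem eq_one_of_pow_eq_one {η : ℂ_[p]} {n : ℕ} (hn : n.Coprime p) (h : η ^ n = 1)
    (h1 : ‖η - 1‖ < 1) : η = 1 := by
  by_contra hne
  have hη : ‖η‖ ≤ 1 := by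
    have := IsUltrametricDist.norm_add_le_max (η - 1) 1
    rw [sub_add_cancel, norm_one] at this
    exact this.trans (max_le h1.le le_rfl)
  have hs : ∑ i ∈ Finset.range n, η ^ i = 0 := by
    have := geom_sum_mul η n
    rw [h, sub_self] at this
    exact (mul_eq_zero.mp this).resolve_right (sub_ne_zero.mpr hne)
  -- The geometric sum, which is `0`, is congruent to `n` modulo `η - 1`; but `n` is a unit.
  have hsub : ‖∑ i ∈ Finset.range n, (η ^ i - 1)‖ ≤ ‖η - 1‖ := by
    refine IsUltrametricDist.norm_sum_le_of_forall_le_of_nonneg (norm_nonneg _) fun i _ => ?_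
    rw [← geom_sum_mul, norm_mul]
    refine mul_le_of_le_one_left (norm_nonneg _) ?_
    refine IsUltrametricDist.norm_sum_le_of_forall_le_of_nonneg zero_le_one fun j _ => ?_
    rw [norm_pow]
    exact pow_le_one₀ (norm_nonneg _) hη
  rw [Finset.sum_sub_distrib, hs] at hsub
  simp only [Finset.sum_const, Finset.card_range, nsmul_eq_mul, mul_one, zero_sub, norm_neg,
    norm_natCast_padicComplex] at hsub
  rw [Padic.norm_natCast_eq_one_iff.mpr hn.symm] at hsub
  exact absurd hsub (not_le.mpr h1)

theorem norm_pow_sub_pow_le {x y : ℂ_[p]} (hx : ‖x‖ ≤ 1) (hy : ‖y‖ ≤ 1) (n : ℕ) :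
    ‖x ^ n - y ^ n‖ ≤ ‖x - y‖ := by
  rw [← (Commute.all x y).geom_sum₂_mul, norm_mul]
  refine mul_le_of_le_one_left (norm_nonneg _) ?_
  refine IsUltrametricDist.norm_sum_le_of_forall_le_of_nonneg zero_le_one fun j _ => ?_
  rw [norm_mul, norm_pow, norm_pow]
  exact mul_le_one₀ (pow_le_one₀ (norm_nonneg _) hx) (by positivity) (pow_le_one₀ (norm_nonneg _) hy)

/-- Fermat's little theorem for `p`-integral rational numbers. -/
theorem norm_ratCast_pow_sub_one_lt (hr : ‖(r : ℚ_[p])‖ = 1) :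
    ‖(r : ℂ_[p]) ^ (p - 1) - 1‖ < 1 := by
  let z : ℤ_[p] := ⟨(r : ℚ_[p]), hr.le⟩
  have hz : ‖z‖ = 1 := hr
  have h : ‖z ^ (p - 1) - 1‖ < 1 := by
    rw [← PadicInt.mem_nonunits, ← IsLocalRing.mem_maximalIdeal, ← PadicInt.ker_toZMod,
      RingHom.mem_ker, map_sub, map_pow, map_one, sub_eq_zero]
    refine ZMod.pow_card_sub_one_eq_one fun h0 => ?_
    rw [← RingHom.mem_ker, PadicInt.ker_toZMod, IsLocalRing.mem_maximalIdeal,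
      PadicInt.mem_nonunits] at h0
    exact h0.ne hz
  have e : zpToCp p z = (r : ℂ_[p]) := map_ratCast (algebraMap ℚ_[p] ℂ_[p]) r
  rw [← norm_zpToCp, map_sub, map_pow, map_one, e] at h
  exact h

/-- `ζ ^ (p - 1)` is a root of unity of order prime to `p`, congruent to `r ^ (p - 1)` and hence to
`1`. The default value of `teich` also satisfies the identity, so no Teichmüller representative has
to be constructed. -/
theorem teich_pow (hr : ‖(r : ℚ_[p])‖ = 1) : teich p (r : ℂ_[p]) ^ (p - 1) = 1 := by
  rw [teich]
  split_ifs with h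
  · obtain ⟨⟨n, hn, hc, h1⟩, h2⟩ := h.choose_spec
    set ζ := h.choose
    have hζ : ‖ζ‖ = 1 := by
      rw [← pow_eq_one_iff_of_nonneg (norm_nonneg _) hn.ne', ← norm_pow, h1, norm_one]
    refine eq_one_of_pow_eq_one hc (by rw [← pow_mul, mul_comm, pow_mul, h1, one_pow]) ?_
    have h3 := norm_pow_sub_pow_le hζ.le ((norm_ratCast_padicComplex p r).trans hr).le (p - 1)
    rw [norm_sub_rev ζ] at h3
    have h4 := IsUltrametricDist.norm_add_le_max (ζ ^ (p - 1) - (r : ℂ_[p]) ^ (p - 1))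
      ((r : ℂ_[p]) ^ (p - 1) - 1)
    rw [sub_add_sub_cancel] at h4
    exact h4.trans_lt (max_lt (h3.trans_lt h2) (norm_ratCast_pow_sub_one_lt hr))
  · exact one_pow _

end Padic

end IncGamma

end

noncomputable section

namespace IncGamma

open MeasureTheory Filter Topology

/-! ### The function `Φ_f` at the archimedean place -/

/-- The analytic continuation `-r ((1 - z)^(1/r) - 1)` of the sum of `f_r`. -/
def fContinuation (r : ℚ) (z : ℂ) : ℂ := -(r : ℂ) * ((1 - z) ^ (1 / (r : ℂ)) - 1)

theorem coeff_fSeries_complex (r : ℚ) (n : ℕ) :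
    PowerSeries.coeff n ((fSeries r).map (algebraMap ℚ ℂ)) =
      -(r : ℂ) * ((-1) ^ n * Ring.choose (1 / (r : ℂ)) n - if n = 0 then 1 else 0) := by
  rw [fSeries_map_eq, PowerSeries.coeff_C_mul, map_sub, coeff_oneSubPow, PowerSeries.coeff_one]

theorem hasSum_fSeries (r : ℚ) {z : ℂ} (hz : ‖z‖ < 1) :
    HasSum (fun n => PowerSeries.coeff n ((fSeries r).map (algebraMap ℚ ℂ)) * z ^ n)
      (fContinuation r z) := by
  have h := (Complex.one_add_cpow_hasFPowerSeriesOnBall_zero (a := 1 / (r : ℂ))).hasSum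
    (y := -z) (by simpa [← ofReal_norm, ← ENNReal.ofReal_one] using hz)
  have h1 : HasSum (fun n : ℕ => if n = 0 then (1 : ℂ) else 0) 1 := hasSum_ite_eq 0 1
  have h2 := (h.sub h1).mul_left (-(r : ℂ))
  rw [zero_add, ← sub_eq_add_neg] at h2
  refine h2.congr_fun fun n => ?_
  rw [coeff_fSeries_complex, binomialSeries_apply, List.prod_ofFn, Finset.prod_const,
    Finset.card_univ, Fintype.card_fin, smul_eq_mul, neg_pow]
  split_ifs with hn
  · simp [hn]
  · ring

theorem half_lt_radius_fSeries (r : ℚ) :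
    ENNReal.ofReal (1 / 2) < (FormalMultilinearSeries.ofScalars ℂ (fun n =>
      PowerSeries.coeff n ((fSeries r).map (algebraMap ℚ ℂ)))).radius := by
  -- Any radius strictly between `1 / 2` and `1` would do in place of `3 / 4`.
  have hlt : ENNReal.ofReal (1 / 2) < ((3 / 4 : NNReal) : ENNReal) := by
    rw [ENNReal.ofReal, ENNReal.coe_lt_coe, ← NNReal.coe_lt_coe]
    simp
    norm_num
  refine hlt.trans_le (FormalMultilinearSeries.le_radius_of_summable_norm _ ?_)
  have hs : ‖((3 / 4 : ℝ) : ℂ)‖ < 1 := by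
    rw [Complex.norm_real]
    norm_num
  refine ((hasSum_fSeries r hs).summable.norm).congr fun n => ?_
  rw [FormalMultilinearSeries.ofScalars_norm, norm_mul, norm_pow, Complex.norm_real]
  norm_num

theorem one_sub_mem_slitPlane {x : ℝ} (hx : x ≤ 0) : 1 - (x : ℂ) ∈ Complex.slitPlane := by
  rw [Complex.mem_slitPlane_iff]
  left
  simp
  linarith

theorem analyticAt_fContinuation (r : ℚ) {z : ℂ} (hz : 1 - z ∈ Complex.slitPlane) :
    AnalyticAt ℂ (fContinuation r) z :=
  analyticAt_const.mul (((analyticAt_const.sub analyticAt_id).cpow analyticAt_const hz).sub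
    analyticAt_const)

theorem isContinuation_fContinuation (r : ℚ) :
    IsContinuation ((fSeries r).map (algebraMap ℚ ℂ)) {z | 1 - z ∈ Complex.slitPlane}
      (fContinuation r) := by
  -- The domain is the plane cut along `[1, ∞)`, the image of `slitPlane` under `z ↦ 1 - z`; this
  -- carries the star centre `1` to `0`.
  have hstar : StarConvex ℝ (0 : ℂ) {z | 1 - z ∈ Complex.slitPlane} := by
    intro z hz a b ha hb hab
    have := Complex.starConvex_one_slitPlane hz ha hb hab
    simp only [Set.mem_ofPred_eq, smul_zero, zero_add]
    convert this using 1
    simp only [Complex.real_smul]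
    have hab' : (a : ℂ) + b = 1 := by exact_mod_cast hab
    linear_combination -hab'
  have h0 : (0 : ℂ) ∈ {z : ℂ | 1 - z ∈ Complex.slitPlane} := by simp
  refine ⟨Complex.isOpen_slitPlane.preimage (by fun_prop), ?_, fun x hx => one_sub_mem_slitPlane hx,
    fun z hz => analyticAt_fContinuation r hz, 1 / 2, by norm_num, half_lt_radius_fSeries r,
    fun z _ hz => ?_⟩
  · exact (hstar.isPathConnected h0).isConnected
  · exact (hasSum_fSeries r (hz.trans (by norm_num))).tsum_eq.symm

/-- The identity theorem is applied on the half-line itself, which is connected; `V` need not meet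
the cut plane in a connected set. Hence the choice of continuation in `phiComplex` is immaterial. -/
theorem IsContinuation.eq_fContinuation {r : ℚ} {V : Set ℂ} {F : ℂ → ℂ}
    (h : IsContinuation ((fSeries r).map (algebraMap ℚ ℂ)) V F) {x : ℝ} (hx : x ≤ 0) :
    F x = fContinuation r x := by
  obtain ⟨hV, -, hmem, hF, c, hc, -, hsum⟩ := h
  let U : Set ℂ := (fun x : ℝ => (x : ℂ)) '' Set.Iic 0
  have hU : IsPreconnected U := isPreconnected_Iic.image _ Complex.continuous_ofReal.continuousOn
  have h1 : AnalyticOnNhd ℂ F U := by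
    rintro _ ⟨y, hy, rfl⟩
    exact hF _ (hmem y hy)
  have h2 : AnalyticOnNhd ℂ (fContinuation r) U := by
    rintro _ ⟨y, hy, rfl⟩
    exact analyticAt_fContinuation r (one_sub_mem_slitPlane hy)
  have h0 : ((0 : ℝ) : ℂ) ∈ U := ⟨0, by simp, rfl⟩
  refine h1.eqOn_of_preconnected_of_eventuallyEq h2 hU h0 ?_ ⟨x, hx, rfl⟩
  filter_upwards [hV.mem_nhds (hmem 0 le_rfl), Metric.ball_mem_nhds _ hc,
    Metric.ball_mem_nhds _ one_pos] with z hz hz1 hz2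
  rw [Complex.ofReal_zero, mem_ball_zero_iff] at hz1 hz2
  rw [hsum z hz hz1, (hasSum_fSeries r hz2).tsum_eq]

/-! ### The integral over `u ≥ 1` at the infinite place. -/

/-- The weight `exp(-ρ (u^(1/ρ) - 1))` on `[1, ∞)`. -/
def weight (ρ u : ℝ) : ℝ := Real.exp (-ρ * (u ^ (1 / ρ) - 1))

theorem phiComplex_fSeries (r : ℚ) {x : ℝ} (hx : x ≤ 0) :
    phiComplex ((fSeries r).map (algebraMap ℚ ℂ)) x = (weight r (1 - x) : ℂ) := by
  have h : ∃ F : ℂ → ℂ, ∃ V : Set ℂ, IsContinuation ((fSeries r).map (algebraMap ℚ ℂ)) V F :=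
    ⟨_, _, isContinuation_fContinuation r⟩
  obtain ⟨V, hV⟩ := h.choose_spec
  rw [phiComplex, dif_pos h, hV.eq_fContinuation hx, fContinuation, weight]
  push_cast
  rw [Complex.ofReal_cpow (by linarith)]
  push_cast
  rfl

/-- The integral `∫_1^∞ u^y weight(u) du`. -/
def weightIntegral (ρ y : ℝ) : ℝ := ∫ u in Set.Ioi (1 : ℝ), u ^ y * weight ρ u

theorem PhiComplex_fSeries (r : ℚ) (y : ℝ) :
    PhiComplex ((fSeries r).map (algebraMap ℚ ℂ)) y = (weightIntegral r y : ℂ) := by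
  have h1 : PhiComplex ((fSeries r).map (algebraMap ℚ ℂ)) y =
      ∫ x in Set.Iic (0 : ℝ), (((1 - x) ^ y * weight r (1 - x) : ℝ) : ℂ) := by
    refine setIntegral_congr_fun measurableSet_Iic fun x hx => ?_
    rw [phiComplex_fSeries r hx, Complex.ofReal_mul, Complex.ofReal_cpow]
    have : x ≤ 0 := hx
    linarith
  have h2 := (Measure.measurePreserving_sub_left volume (1 : ℝ)).setIntegral_preimage_emb
    (Homeomorph.subLeft (1 : ℝ)).measurableEmbedding (fun u => u ^ y * weight r u) (Set.Ici 1)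
  have h3 : (fun t : ℝ => 1 - t) ⁻¹' Set.Ici 1 = Set.Iic 0 := by
    ext t
    simp
  rw [h1, integral_complex_ofReal, weightIntegral, ← integral_Ici_eq_integral_Ioi, ← h2, h3]

section Weight

variable {ρ : ℝ}

theorem hasDerivAt_weight (hρ : ρ ≠ 0) {u : ℝ} (hu : 0 < u) :
    HasDerivAt (weight ρ) (-(u ^ (1 / ρ - 1) * weight ρ u)) u := by
  have h := (((Real.hasDerivAt_rpow_const (p := 1 / ρ) (Or.inl hu.ne')).sub_const 1).const_mul
    (-ρ)).exp
  convert! h using 1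
  simp only [weight]
  field_simp

theorem continuousOn_rpow_mul_weight (hρ : ρ ≠ 0) (y : ℝ) :
    ContinuousOn (fun u => u ^ y * weight ρ u) (Set.Ici 1) := by
  intro u hu
  have hu' : 0 < u := lt_of_lt_of_le one_pos hu
  exact ((Real.continuousAt_rpow_const _ _ (Or.inl hu'.ne')).mul
    (hasDerivAt_weight hρ hu').continuousAt).continuousWithinAt

theorem weight_one : weight ρ 1 = 1 := by simp [weight]

/-- The differential equation of `derivative_oneSubPow_mul_expComp` in the variable `u = 1 - t`,
with the sign reversed. -/
theorem hasDerivAt_rpow_mul_weight (hρ : ρ ≠ 0) (y : ℝ) {u : ℝ} (hu : 0 < u) :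
    HasDerivAt (fun u => u ^ (y + 1) * weight ρ u)
      ((y + 1) * (u ^ y * weight ρ u) - u ^ (y + 1 / ρ) * weight ρ u) u := by
  have h := (Real.hasDerivAt_rpow_const (p := y + 1) (Or.inl hu.ne')).mul (hasDerivAt_weight hρ hu)
  convert! h using 1
  rw [add_sub_cancel_right, show y + 1 / ρ = (y + 1) + (1 / ρ - 1) by ring, Real.rpow_add hu]
  ring

theorem integrableOn_rpow_mul_weight (hρ : ρ ≠ 0) {y z : ℝ} (hz : z < -1)
    (h : (fun u => u ^ y * weight ρ u) =O[atTop] fun u => u ^ z) :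
    IntegrableOn (fun u => u ^ y * weight ρ u) (Set.Ioi 1) :=
  (((continuousOn_rpow_mul_weight hρ y).locallyIntegrableOn
    measurableSet_Ici).integrableOn_of_isBigO_atTop h
      (integrableAtFilter_rpow_atTop_iff.mpr hz)).mono_set Set.Ioi_subset_Ici_self

theorem weightIntegral_add (hρ : ρ ≠ 0) {y : ℝ}
    (h1 : IntegrableOn (fun u => u ^ y * weight ρ u) (Set.Ioi 1))
    (h2 : IntegrableOn (fun u => u ^ (y + 1 / ρ) * weight ρ u) (Set.Ioi 1))
    (h3 : Tendsto (fun u => u ^ (y + 1) * weight ρ u) atTop (𝓝 0)) :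
    weightIntegral ρ (y + 1 / ρ) = 1 + (y + 1) * weightIntegral ρ y := by
  have h := integral_Ioi_of_hasDerivAt_of_tendsto'
    (fun u hu => hasDerivAt_rpow_mul_weight hρ y (lt_of_lt_of_le one_pos hu))
    ((h1.const_mul (y + 1)).sub h2) h3
  rw [integral_sub (h1.const_mul (y + 1)) h2, integral_const_mul, Real.one_rpow, weight_one] at h
  simp only [weightIntegral]
  linarith

/-- The integrand is minus the derivative of the weight. This replaces `weightIntegral_add` at `y =
-1`, whose hypotheses fail for `ρ < 0`; the limit `l` is `0` for `ρ > 0` and `exp ρ` for `ρ < 0`. -/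
theorem weightIntegral_start (hρ : ρ ≠ 0) {l : ℝ}
    (h : IntegrableOn (fun u => u ^ (1 / ρ - 1) * weight ρ u) (Set.Ioi 1))
    (hl : Tendsto (weight ρ) atTop (𝓝 l)) :
    weightIntegral ρ (1 / ρ - 1) = 1 - l := by
  have h := integral_Ioi_of_hasDerivAt_of_tendsto'
    (fun u hu => hasDerivAt_weight hρ (lt_of_lt_of_le one_pos hu)) h.neg hl
  rw [integral_neg, weight_one] at h
  simp only [weightIntegral]
  linarith

/-- In terms of `v = u ^ (1 / ρ)` this is `v ^ (ρ * y) * exp (-ρ * v)` up to a constant. -/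
theorem tendsto_rpow_mul_weight_of_pos (hρ : 0 < ρ) (y : ℝ) :
    Tendsto (fun u => u ^ y * weight ρ u) atTop (𝓝 0) := by
  have h := ((tendsto_rpow_mul_exp_neg_mul_atTop_nhds_zero (ρ * y) ρ hρ).comp
    (tendsto_rpow_atTop (one_div_pos.mpr hρ))).mul_const (Real.exp ρ)
  rw [zero_mul] at h
  refine h.congr' ?_
  filter_upwards [eventually_gt_atTop 0] with u hu
  simp only [Function.comp_apply]
  rw [← Real.rpow_mul hu.le, weight, mul_assoc, ← Real.exp_add]
  congr 2
  · field_simp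
  · ring

theorem integrableOn_rpow_mul_weight_of_pos (hρ : 0 < ρ) (y : ℝ) :
    IntegrableOn (fun u => u ^ y * weight ρ u) (Set.Ioi 1) := by
  refine integrableOn_rpow_mul_weight hρ.ne' (z := -2) (by norm_num) ?_
  have h := (tendsto_rpow_mul_weight_of_pos hρ (y + 2)).isBigO_one ℝ
  have h2 := (Asymptotics.isBigO_refl (fun u : ℝ => u ^ (-2 : ℝ)) atTop).mul h
  refine (h2.congr' ?_ ?_)
  · filter_upwards [eventually_gt_atTop 0] with u hu
    rw [← mul_assoc, ← Real.rpow_add hu]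
    ring_nf
  · filter_upwards with u
    rw [mul_one]

theorem tendsto_weight_of_neg (hρ : ρ < 0) : Tendsto (weight ρ) atTop (𝓝 (Real.exp ρ)) := by
  have h := tendsto_rpow_neg_atTop (y := -(1 / ρ)) (by rw [neg_pos, one_div_neg]; exact hρ)
  rw [neg_neg] at h
  have h2 := (Real.continuous_exp.tendsto _).comp ((h.sub_const 1).const_mul (-ρ))
  rw [zero_sub, mul_neg_one, neg_neg] at h2
  exact h2

theorem integrableOn_rpow_mul_weight_of_neg (hρ : ρ < 0) {y : ℝ} (hy : y < -1) :
    IntegrableOn (fun u => u ^ y * weight ρ u) (Set.Ioi 1) := by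
  refine integrableOn_rpow_mul_weight hρ.ne hy ?_
  have h := (Asymptotics.isBigO_refl (fun u : ℝ => u ^ y) atTop).mul
    ((tendsto_weight_of_neg hρ).isBigO_one ℝ)
  simpa using h

end Weight

theorem weightIntegral_of_pos {r : ℚ} (hr : 0 < r) (m : ℕ) :
    weightIntegral r (1 / r * (m + 1) - 1) = (psiTilde r m : ℚ) := by
  have hρ : (0 : ℝ) < r := by exact_mod_cast hr
  induction m with
  | zero =>
    have h := weightIntegral_start hρ.ne' (integrableOn_rpow_mul_weight_of_pos hρ _)
      (l := 0) (by simpa using tendsto_rpow_mul_weight_of_pos hρ 0)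
    simpa [psiTilde] using h
  | succ m ih =>
    have h := weightIntegral_add hρ.ne' (integrableOn_rpow_mul_weight_of_pos hρ _)
      (integrableOn_rpow_mul_weight_of_pos hρ _)
      (tendsto_rpow_mul_weight_of_pos hρ (1 / r * ((m : ℝ) + 1) - 1 + 1))
    rw [ih] at h
    rw [show (1 / (r : ℝ)) * (((m + 1 : ℕ) : ℝ) + 1) - 1 =
      1 / r * ((m : ℝ) + 1) - 1 + 1 / r by push_cast; ring, h]
    simp only [psiTilde]
    push_cast
    ring

/-- The exponents are below `-1`, so the integrals converge although the weight does not decay. The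
defect is `exp r` at `m = 0`, and it then follows the homogeneous recursion with factor `(m + 1) /
r`. -/
theorem weightIntegral_of_neg {r : ℚ} (hr : r < 0) (m : ℕ) :
    weightIntegral r (1 / r * (m + 1) - 1) =
      (psiTilde r m : ℚ) - Real.exp r * m.factorial / (r : ℝ) ^ m := by
  have hρ : (r : ℝ) < 0 := by exact_mod_cast hr
  have hneg : ∀ m : ℕ, 1 / (r : ℝ) * ((m : ℝ) + 1) < 0 := fun m =>
    mul_neg_of_neg_of_pos (one_div_neg.mpr hρ) (by positivity)
  have hint : ∀ m : ℕ, IntegrableOn (fun u => u ^ (1 / (r : ℝ) * ((m : ℝ) + 1) - 1) * weight r u)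
      (Set.Ioi 1) := fun m =>
    integrableOn_rpow_mul_weight_of_neg hρ (by linarith [hneg m])
  induction m with
  | zero =>
    have h := weightIntegral_start hρ.ne (by simpa using hint 0) (tendsto_weight_of_neg hρ)
    simpa [psiTilde] using h
  | succ m ih =>
    have e : (1 / (r : ℝ)) * (((m + 1 : ℕ) : ℝ) + 1) - 1 =
      1 / r * ((m : ℝ) + 1) - 1 + 1 / r := by push_cast; ring
    have ht : Tendsto (fun u => u ^ (1 / (r : ℝ) * ((m : ℝ) + 1) - 1 + 1) * weight r u) atTop
        (𝓝 0) := by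
      have h1 := tendsto_rpow_neg_atTop (y := -(1 / (r : ℝ) * ((m : ℝ) + 1)))
        (by linarith [hneg m])
      have h2 := h1.mul (tendsto_weight_of_neg hρ)
      rw [neg_neg, zero_mul] at h2
      simpa using h2
    have h := weightIntegral_add hρ.ne (hint m) (e ▸ hint (m + 1)) ht
    rw [ih] at h
    rw [e, h]
    simp only [psiTilde, Nat.factorial_succ, pow_succ]
    push_cast
    have := hρ.ne
    field_simp
    ring

end IncGamma

end

noncomputable section

namespace IncGamma

open MeasureTheory Filter Topology

/-! ### The incomplete gamma functions at positive integers -/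

/-- A primitive of `w ^ m exp(-w)`. -/
def gammaPrimitive : ℕ → ℂ → ℂ
  | 0, w => -Complex.exp (-w)
  | m + 1, w => ((m : ℂ) + 1) * gammaPrimitive m w - w ^ (m + 1) * Complex.exp (-w)

theorem hasDerivAt_gammaPrimitive (m : ℕ) (w : ℂ) :
    HasDerivAt (gammaPrimitive m) (w ^ m * Complex.exp (-w)) w := by
  have he : HasDerivAt (fun w : ℂ => Complex.exp (-w)) (-Complex.exp (-w)) w := by
    simpa using (hasDerivAt_neg w).cexp
  induction m with
  | zero => simpa [gammaPrimitive] using! he.neg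
  | succ m ih =>
    have h := (ih.const_mul ((m : ℂ) + 1)).sub ((hasDerivAt_pow (m + 1) w).mul he)
    convert! h using 1
    push_cast [add_tsub_cancel_right]
    ring

theorem gammaPrimitive_zero (m : ℕ) : gammaPrimitive m 0 = -(m.factorial : ℂ) := by
  induction m with
  | zero => simp [gammaPrimitive]
  | succ m ih =>
    simp only [gammaPrimitive, ih, Nat.factorial_succ]
    push_cast
    simp

theorem tendsto_gammaPrimitive {α : Type*} {l : Filter α} {g : α → ℂ}
    (h : ∀ k : ℕ, Tendsto (fun x => g x ^ k * Complex.exp (-g x)) l (𝓝 0)) (m : ℕ) :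
    Tendsto (fun x => gammaPrimitive m (g x)) l (𝓝 0) := by
  induction m with
  | zero => simpa [gammaPrimitive] using (h 0).neg
  | succ m ih => simpa [gammaPrimitive] using (ih.const_mul ((m : ℂ) + 1)).sub (h (m + 1))

theorem powBranch_natCast (θ : ℝ) {w : ℂ} (hw : w ≠ 0) (m : ℕ) : powBranch θ w m = w ^ m := by
  rw [powBranch, Complex.exp_nat_mul, exp_logBranch θ hw]

theorem continuous_gammaPrimitive (m : ℕ) : Continuous (gammaPrimitive m) :=
  continuous_iff_continuousAt.mpr fun w => (hasDerivAt_gammaPrimitive m w).continuousAt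

theorem lowerGamma_natCast_add_one (θ : ℝ) {r : ℂ} (hr : r ≠ 0) (m : ℕ) :
    lowerGamma θ (m + 1) r = gammaPrimitive m r + m.factorial := by
  refine Tendsto.limUnder_eq ?_
  have hlim : Tendsto (fun N : ℕ => gammaPrimitive m r - gammaPrimitive m (((1 / N : ℝ) : ℂ) * r))
      atTop (𝓝 (gammaPrimitive m r + m.factorial)) := by
    have h0 : Tendsto (fun N : ℕ => ((1 / N : ℝ) : ℂ) * r) atTop (𝓝 0) := by
      have := (Complex.continuous_ofReal.tendsto 0).comp (tendsto_one_div_atTop_nhds_zero_nat)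
      simpa [Function.comp_def] using this.mul_const r
    have h1 := ((continuous_gammaPrimitive m).tendsto 0).comp h0
    rw [gammaPrimitive_zero] at h1
    simpa [sub_neg_eq_add] using h1.const_sub (gammaPrimitive m r)
  refine hlim.congr' ?_
  -- For `N > 0` the segment avoids `0`, where `powBranch` need not be the ordinary power.
  filter_upwards [eventually_gt_atTop 0] with N hN
  have hN' : (0 : ℝ) < 1 / N := by positivity
  have hN1 : (1 / N : ℝ) ≤ 1 := by
    rw [div_le_one (by positivity)]
    exact_mod_cast hN
  have hcongr : (∫ t in (1 / N : ℝ)..1,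
      powBranch θ (t * r) ((m : ℂ) + 1 - 1) * Complex.exp (-(t * r)) * r) =
      ∫ t in (1 / N : ℝ)..1, ((t : ℂ) * r) ^ m * Complex.exp (-(t * r)) * r := by
    refine intervalIntegral.integral_congr fun t ht => ?_
    rw [Set.uIcc_of_le hN1] at ht
    have ht0 : (t : ℂ) ≠ 0 := Complex.ofReal_ne_zero.mpr (hN'.trans_le ht.1).ne'
    simp only [add_sub_cancel_right]
    rw [powBranch_natCast θ (mul_ne_zero ht0 hr)]
  rw [hcongr, intervalIntegral.integral_eq_sub_of_hasDerivAt
    (f := fun t : ℝ => gammaPrimitive m ((t : ℂ) * r))]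
  · simp
  · intro t _
    have h1 : HasDerivAt (fun t : ℝ => (t : ℂ) * r) r t := by
      simpa using (Complex.ofRealCLM.hasDerivAt (x := t)).mul_const r
    exact (hasDerivAt_gammaPrimitive m _).comp t h1
  · exact Continuous.intervalIntegrable (by fun_prop) _ _

/-! ### Integration along contours. -/

theorem IsAdmissible.ne_zero {θ : ℝ} {r : ℂ} {κ : ℝ → ℂ} (h : IsAdmissible θ r κ) {t : ℝ}
    (ht : 0 ≤ t) : κ t ≠ 0 := fun h0 => h.avoids t ht ⟨0, le_rfl, by simp [h0]⟩

/-- The fundamental theorem of calculus along a piece of a contour. -/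
theorem integral_piece {g g' : ℂ → ℂ} (hg : ∀ w, HasDerivAt g (g' w) w) (hg' : Continuous g')
    {κ : ℝ → ℂ} {a b : ℝ} (hab : a ≤ b) (hκ : ContDiffOn ℝ 1 κ (Set.Icc a b)) :
    IntervalIntegrable (fun t => g' (κ t) * deriv κ t) volume a b ∧
      ∫ t in a..b, g' (κ t) * deriv κ t = g (κ b) - g (κ a) := by
  rcases hab.eq_or_lt with rfl | hlt
  · simp
  have hd : ∀ t ∈ Set.Ioo a b, HasDerivAt κ (deriv κ t) t := fun t ht =>
    (((hκ.differentiableOn one_ne_zero) t (Set.Ioo_subset_Icc_self ht)).differentiableAt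
      (Icc_mem_nhds ht.1 ht.2)).hasDerivAt
  have hc : Continuous g := continuous_iff_continuousAt.mpr fun w => (hg w).continuousAt
  have hint : IntervalIntegrable (fun t => g' (κ t) * deriv κ t) volume a b := by
    -- `deriv κ` is uncontrolled at the break points. `derivWithin` is continuous up to the ends and
    -- agrees with it inside.
    have h1 : ContinuousOn (fun t => g' (κ t) * derivWithin κ (Set.Icc a b) t) (Set.uIcc a b) := by
      rw [Set.uIcc_of_le hab]
      exact (hg'.comp_continuousOn hκ.continuousOn).mul
        (hκ.continuousOn_derivWithin (uniqueDiffOn_Icc hlt) le_rfl)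
    refine h1.intervalIntegrable.congr_uIoo fun t ht => ?_
    rw [Set.uIoo_of_le hab] at ht
    simp only
    rw [derivWithin_of_mem_nhds (Icc_mem_nhds ht.1 ht.2)]
  refine ⟨hint, intervalIntegral.integral_eq_sub_of_hasDerivAt_of_le (f := fun t => g (κ t)) hab
    (hc.comp_continuousOn hκ.continuousOn) (fun t ht => ?_) hint⟩
  exact (hg _).comp t (hd t ht)

theorem IsContourOn.integral_eq {g g' : ℂ → ℂ} (hg : ∀ w, HasDerivAt g (g' w) w)
    (hg' : Continuous g') {κ : ℝ → ℂ} {ν : ℝ} (hκ : IsContourOn κ ν) :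
    ∫ t in (0 : ℝ)..ν, g' (κ t) * deriv κ t = g (κ ν) - g (κ 0) := by
  obtain ⟨n, t, ht, h0, hn, hC⟩ := hκ
  have hp := fun i (hi : i < n) => integral_piece hg hg' (ht (Nat.le_succ i)) (hC i hi)
  rw [← h0, ← hn, ← intervalIntegral.sum_integral_adjacent_intervals fun i hi => (hp i hi).1,
    Finset.sum_congr rfl fun i hi => (hp i (Finset.mem_range.mp hi)).2,
    Finset.sum_range_sub (fun i => g (κ (t i)))]

/-- In a closed subsector of the right half-plane the real part is at least `δ * ‖κ t‖`, so the
exponential wins. -/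
theorem IsAdmissible.tendsto_pow_mul_exp {θ : ℝ} {r : ℂ} {κ : ℝ → ℂ} (h : IsAdmissible θ r κ)
    (k : ℕ) : Tendsto (fun t => κ t ^ k * Complex.exp (-κ t)) atTop (𝓝 0) := by
  obtain ⟨α₁, hα₁, α₂, hα₂, t₀, -, hs⟩ := h.sector
  set δ := min (Real.cos α₁) (Real.cos α₂)
  have hδ : 0 < δ := lt_min (Real.cos_pos_of_mem_Ioo hα₁) (Real.cos_pos_of_mem_Ioo hα₂)
  have hre : ∀ t ≥ t₀, δ * ‖κ t‖ ≤ (κ t).re := by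
    intro t ht
    obtain ⟨-, h1, h2⟩ := hs t ht
    rw [← Complex.norm_mul_cos_arg (κ t), mul_comm]
    refine mul_le_mul_of_nonneg_left ?_ (norm_nonneg _)
    rcases le_total 0 (κ t).arg with h0 | h0
    · exact (min_le_right _ _).trans
        (Real.cos_le_cos_of_nonneg_of_le_pi h0 (by linarith [hα₂.2, Real.pi_pos]) h2)
    · refine (min_le_left _ _).trans ?_
      rw [← Real.cos_neg α₁, ← Real.cos_neg (κ t).arg]
      exact Real.cos_le_cos_of_nonneg_of_le_pi (by linarith) (by linarith [hα₁.1, Real.pi_pos])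
        (by linarith)
  have hb : Tendsto (fun t => ‖κ t‖ ^ (k : ℝ) * Real.exp (-δ * ‖κ t‖)) atTop (𝓝 0) :=
    (tendsto_rpow_mul_exp_neg_mul_atTop_nhds_zero k δ hδ).comp h.tendsto
  refine squeeze_zero_norm' ?_ hb
  filter_upwards [eventually_ge_atTop t₀] with t ht
  rw [norm_mul, norm_pow, Complex.norm_exp, Real.rpow_natCast, Complex.neg_re]
  gcongr
  linarith [hre t ht]

/-- The primitive vanishes at the far end of the contour. The value does not involve `κ`, so the
choice in `upperGamma` does not matter. -/
theorem upperGammaAlong_natCast_add_one {θ : ℝ} {r : ℂ} {κ : ℝ → ℂ} (h : IsAdmissible θ r κ)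
    (m : ℕ) : upperGammaAlong θ κ (m + 1) = -gammaPrimitive m r := by
  refine Tendsto.limUnder_eq ?_
  have hlim : Tendsto (fun N : ℕ => gammaPrimitive m (κ N) - gammaPrimitive m (κ 0)) atTop
      (𝓝 (-gammaPrimitive m r)) := by
    have h1 := ((tendsto_gammaPrimitive h.tendsto_pow_mul_exp m).comp
      tendsto_natCast_atTop_atTop).sub_const (gammaPrimitive m (κ 0))
    rw [zero_sub, h.start] at h1
    rw [h.start]
    exact h1
  refine hlim.congr fun N => ?_
  rw [← (h.contour N N.cast_nonneg).integral_eq (hasDerivAt_gammaPrimitive m) (by fun_prop)]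
  refine intervalIntegral.integral_congr fun t ht => ?_
  rw [Set.uIcc_of_le N.cast_nonneg] at ht
  simp only [add_sub_cancel_right]
  rw [powBranch_natCast θ (h.ne_zero ht.1)]

/-! ### Existence of admissible contours. -/

/-- A half-line is an admissible contour if it avoids `R_θ` and has a suitable direction. -/
theorem isAdmissible_halfLine {θ : ℝ} {r v : ℂ} (hv : 0 < v.re)
    (havoid : ∀ t : ℝ, 0 ≤ t → r + t * v ∉ ray θ)
    (hbelow : 0 < Real.cos θ → v.im * Real.cos θ < v.re * Real.sin θ) :
    IsAdmissible θ r fun t : ℝ => r + t * v := by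
  have hv0 : v ≠ 0 := by
    rintro rfl
    simp at hv
  refine ⟨fun ν hν => ⟨1, fun i => if i = 0 then 0 else ν, ?_, by simp, by simp, fun i _ => ?_⟩,
    ?_, ?_, havoid, fun hc => ?_, by simp⟩
  · refine monotone_nat_of_le_succ fun i => ?_
    by_cases hi : i = 0 <;> simp [hi, hν]
  · exact (contDiff_const.add (Complex.ofRealCLM.contDiff.mul contDiff_const)).contDiffOn
  · have h1 : Tendsto (fun t : ℝ => t * ‖v‖ - ‖r‖) atTop atTop :=
      tendsto_atTop_add_const_right _ _ (tendsto_id.atTop_mul_const (norm_pos_iff.mpr hv0))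
    refine tendsto_atTop_mono' _ ?_ h1
    filter_upwards [eventually_ge_atTop 0] with t ht
    have h2 := norm_sub_norm_le ((t : ℂ) * v) (-r)
    rw [norm_mul, Complex.norm_real, Real.norm_of_nonneg ht, norm_neg, sub_neg_eq_add,
      add_comm _ r] at h2
    exact h2
  -- After rescaling by `1 / t` the half-line converges to `v`, so its argument tends to `v.arg`;
  -- the sector is bounded by the midpoints between `v.arg` and `±π / 2`.
  · have hlim : Tendsto (fun t : ℝ => ((t⁻¹ : ℝ) : ℂ) * (r + t * v)) atTop (𝓝 v) := by
      have h1 : Tendsto (fun t : ℝ => ((t⁻¹ : ℝ) : ℂ) * r + v) atTop (𝓝 v) := by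
        have := (Complex.continuous_ofReal.tendsto 0).comp tendsto_inv_atTop_zero
        simpa [Function.comp_def] using (this.mul_const r).add_const v
      refine h1.congr' ?_
      filter_upwards [eventually_gt_atTop 0] with t ht
      have : (t : ℂ) ≠ 0 := Complex.ofReal_ne_zero.mpr ht.ne'
      push_cast
      field_simp
    have hvs : v ∈ Complex.slitPlane := Or.inl hv
    have harg := (Complex.continuousAt_arg hvs).tendsto.comp hlim
    have hre := (Complex.continuous_re.tendsto v).comp hlim
    have hva := abs_lt.mp (Complex.abs_arg_lt_pi_div_two_iff.mpr (Or.inl hv))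
    have hpi := Real.pi_pos
    obtain ⟨t₀, ht₀⟩ := eventually_atTop.mp ((eventually_gt_atTop (0 : ℝ)).and
      ((hre.eventually_const_lt hv).and
      ((harg.eventually_const_lt (show (v.arg - Real.pi / 2) / 2 < v.arg by linarith)).and
      (harg.eventually_lt_const (show v.arg < (v.arg + Real.pi / 2) / 2 by linarith)))))
    refine ⟨(v.arg - Real.pi / 2) / 2, ⟨?_, ?_⟩, (v.arg + Real.pi / 2) / 2, ⟨?_, ?_⟩, max t₀ 0, le_max_right _ _, fun t ht => ?_⟩
    rotate_left 4
    · obtain ⟨h0, h1, h2, h3⟩ := ht₀ t ((le_max_left _ _).trans ht)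
      have hi : 0 < t⁻¹ := inv_pos.mpr h0
      simp only [Function.comp_apply, Complex.arg_real_mul _ hi, Complex.re_ofReal_mul] at h1 h2 h3
      exact ⟨pos_of_mul_pos_right h1 hi.le, h2.le, h3.le⟩
    all_goals linarith
  · have hpos : 0 < v.re * Real.sin θ - v.im * Real.cos θ := sub_pos.mpr (hbelow hc)
    have h1 : Tendsto (fun t : ℝ => t * (v.re * Real.sin θ - v.im * Real.cos θ) +
        (r.re * Real.sin θ - r.im * Real.cos θ)) atTop atTop :=
      tendsto_atTop_add_const_right _ _ (tendsto_id.atTop_mul_const hpos)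
    obtain ⟨t₁, ht₁⟩ := eventually_atTop.mp (h1.eventually_ge_atTop 0)
    refine ⟨max t₁ 0, le_max_right _ _, fun t ht => ?_⟩
    have := ht₁ t ((le_max_left _ _).trans ht)
    simp only [Complex.add_re, Complex.add_im, Complex.re_ofReal_mul, Complex.im_ofReal_mul]
    linarith

theorem ray_re_im {θ : ℝ} {z : ℂ} (hz : z ∈ ray θ) :
    ∃ a : ℝ, 0 ≤ a ∧ z.re = a * Real.cos θ ∧ z.im = a * Real.sin θ := by
  obtain ⟨a, ha, rfl⟩ := hz
  refine ⟨a, ha, ?_, ?_⟩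
  · rw [Complex.re_ofReal_mul, Complex.exp_ofReal_mul_I_re]
  · rw [Complex.im_ofReal_mul, Complex.exp_ofReal_mul_I_im]

/-- If `R_θ` is in the closed upper half-plane, leave downwards; if it points into the lower left,
leave upwards. If it lies in the open fourth quadrant, the path must end below it, so the direction
is made steeper than the ray. -/
theorem exists_isAdmissible {θ ρ : ℝ} (hρ : ρ < 0) (h : (ρ : ℂ) ∉ ray θ) :
    ∃ κ, IsAdmissible θ ρ κ := by
  rcases le_or_gt 0 (Real.sin θ) with hs | hs
  · refine ⟨_, isAdmissible_halfLine (v := ⟨1, -1⟩) one_pos (fun t ht hmem => ?_) fun hc => ?_⟩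
    · obtain ⟨a, ha, -, him⟩ := ray_re_im hmem
      simp only [Complex.add_im, Complex.ofReal_im, Complex.im_ofReal_mul] at him
      have : 0 ≤ a * Real.sin θ := mul_nonneg ha hs
      obtain rfl : t = 0 := by linarith
      simp only [Complex.ofReal_zero, zero_mul, add_zero] at hmem
      exact h hmem
    · simp only
      linarith
  rcases le_or_gt (Real.cos θ) 0 with hc | hc
  · refine ⟨_, isAdmissible_halfLine (v := ⟨1, 1⟩) one_pos (fun t ht hmem => ?_)
      fun hc' => absurd hc' (not_lt.mpr hc)⟩
    obtain ⟨a, ha, -, him⟩ := ray_re_im hmem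
    simp only [Complex.add_im, Complex.ofReal_im, Complex.im_ofReal_mul] at him
    have : a * Real.sin θ ≤ 0 := mul_nonpos_of_nonneg_of_nonpos ha hs.le
    obtain rfl : t = 0 := by linarith
    simp only [Complex.ofReal_zero, zero_mul, add_zero] at hmem
    exact h hmem
  · refine ⟨_, isAdmissible_halfLine (v := ⟨Real.cos θ, 2 * Real.sin θ⟩) hc
      (fun t ht hmem => ?_) fun _ => ?_⟩
    · obtain ⟨a, ha, hre, him⟩ := ray_re_im hmem
      simp only [Complex.add_im, Complex.ofReal_im, Complex.im_ofReal_mul, Complex.add_re,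
        Complex.ofReal_re, Complex.re_ofReal_mul] at him hre
      -- A meeting point forces `a = 2 * t`, and then `ρ = t * cos θ ≥ 0`.
      obtain rfl : 2 * t = a := mul_right_cancel₀ hs.ne (by linarith)
      have : 0 ≤ t * Real.cos θ := mul_nonneg ht hc.le
      linarith
    · have := mul_neg_of_pos_of_neg hc hs
      simp only
      linarith

theorem gammaHat_natCast_add_one {θ ρ : ℝ} (hρ : ρ < 0) (h : (ρ : ℂ) ∉ ray θ) (m : ℕ) :
    gammaHat θ ρ (m + 1) = m.factorial := by
  have hex := exists_isAdmissible hρ h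
  rw [gammaHat, upperGamma, dif_pos hex, upperGammaAlong_natCast_add_one hex.choose_spec,
    lowerGamma_natCast_add_one θ (Complex.ofReal_ne_zero.mpr hρ.ne)]
  ring

end IncGamma

end

noncomputable section

namespace IncGamma

/-! ### Comparison of the places -/

theorem Psi_infinite {r : ℚ} (hr : r ≠ 0) {θ : ℝ} (hθ : r < 0 → (r : ℂ) ∉ ray θ) (m : ℕ) :
    powBranch θ (r : ℂ) (m : ℂ) * PhiComplex ((fSeries r).map (algebraMap ℚ ℂ))
        (((1 / r : ℚ) : ℂ) * ((m : ℂ) + 1) - 1) +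
      (if r < 0 then Complex.exp (r : ℂ) * gammaHat θ (r : ℂ) ((m : ℂ) + 1) else 0) =
      (r : ℂ) ^ m * ((psiTilde r m : ℚ) : ℂ) := by
  have hr' : (r : ℂ) ≠ 0 := Rat.cast_ne_zero.mpr hr
  have e : ((1 / r : ℚ) : ℂ) * ((m : ℂ) + 1) - 1 =
      ((1 / (r : ℝ) * ((m : ℝ) + 1) - 1 : ℝ) : ℂ) := by
    push_cast
    rfl
  rw [powBranch_natCast θ hr', e, PhiComplex_fSeries]
  rcases hr.lt_or_gt with h | h
  · have hρ : (r : ℝ) < 0 := by exact_mod_cast h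
    have hg := gammaHat_natCast_add_one (θ := θ) hρ (by simpa using hθ h) m
    rw [Complex.ofReal_ratCast] at hg
    -- Multiplied by `r ^ m`, the defect of the integral is exactly `exp r * m!`, which the
    -- correction term restores.
    rw [if_pos h, hg, weightIntegral_of_neg h]
    push_cast
    field_simp
    ring
  · rw [if_neg h.not_gt, weightIntegral_of_pos h]
    simp

variable {p : ℕ} [Fact p.Prime]

theorem Psi_finite {r : ℚ} (hr : r ≠ 0) (hv : padicValRat p r = 0) (m : ℕ) :
    unitPow p ((r : ℂ_[p]) / teich p r) (m : ℤ_[p]) *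
        PhiPadic p ((fSeries r).map (algebraMap ℚ ℂ_[p])) (ratToZp p (1 / r) * ((m : ℤ_[p]) + 1) - 1) +
      0 = ((r : ℂ_[p]) / teich p r) ^ m * ((psiTilde r m : ℚ) : ℂ_[p]) := by
  have hn := norm_ratCast_eq_one (p := p) hr hv
  have hw : zpToCp p (ratToZp p (1 / r)) = 1 / (r : ℂ_[p]) := by
    rw [zpToCp_ratToZp (by rw [Rat.cast_div, norm_div, hn]; simp)]
    push_cast
    rfl
  rw [add_zero, unitPow_natCast, PhiPadic_fSeries hr hn.le hw]

theorem padicValRat_eq_zero_of_notMem_badPlaces {r : ℚ}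
    (h : RatPlace.finite p ∉ badPlaces r) : padicValRat p r = 0 := by
  by_contra hne
  exact h ⟨p, inferInstance, rfl, hne⟩

theorem princ_ne_zero {r : ℚ} (hr : r ≠ 0) (P : RatPlace) : princ P (r : P.Omega) ≠ 0 := by
  cases P with
  | infinite => exact (Rat.cast_ne_zero.mpr hr : (r : ℂ) ≠ 0)
  | finite p =>
    exact (div_ne_zero (Rat.cast_ne_zero.mpr hr) (teich_ne_zero _) :
      (r : ℂ_[p]) / teich p (r : ℂ_[p]) ≠ 0)

theorem Psi_natCast {r : ℚ} (hr : r ≠ 0) {θ : ℝ} (hθ : r < 0 → (r : ℂ) ∉ ray θ) {P : RatPlace}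
    (hP : P ∉ badPlaces r) (m : ℕ) :
    Psi θ r P (m : P.Post) = princ P (r : P.Omega) ^ m * ((psiTilde r m : ℚ) : P.Omega) := by
  cases P with
  | infinite => exact Psi_infinite hr hθ m
  | finite p => exact Psi_finite hr (padicValRat_eq_zero_of_notMem_badPlaces hP) m

/-- At the infinite place the divisor is `-1`, hence no condition, and `princ` is the identity
there; at a finite place `teich_pow` removes the denominator. -/
theorem princ_pow_eq {r : ℚ} (hr : r ≠ 0) {P : RatPlace} (hP : P ∉ badPlaces r) {m : ℕ}
    (hm : (P.resChar : ℤ) - 1 ∣ m) : princ P (r : P.Omega) ^ m = (r : P.Omega) ^ m := by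
  cases P with
  | infinite => rfl
  | @finite p hp =>
    have hn := norm_ratCast_eq_one (p := p) hr (padicValRat_eq_zero_of_notMem_badPlaces hP)
    have h1 : p - 1 ∣ m := by
      rw [← Int.natCast_dvd_natCast, Nat.cast_sub hp.out.one_le, Nat.cast_one]
      exact hm
    obtain ⟨k, rfl⟩ := h1
    have h2 : ((r : ℂ_[p]) / teich p (r : ℂ_[p])) ^ ((p - 1) * k) = (r : ℂ_[p]) ^ ((p - 1) * k) := by
      rw [div_pow, pow_mul (teich p (r : ℂ_[p])), teich_pow hn, one_pow, div_one]
    exact h2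

theorem charZero_Omega : (P : RatPlace) → CharZero P.Omega
  | .infinite => inferInstanceAs (CharZero ℂ)
  | @RatPlace.finite p _ => inferInstanceAs (CharZero ℂ_[p])

theorem Psi_natCast_eq_ratCast {r : ℚ} (hr : r ≠ 0) {θ : ℝ} (hθ : r < 0 → (r : ℂ) ∉ ray θ)
    {P : RatPlace} (hP : P ∉ badPlaces r) {m : ℕ} (hm : (P.resChar : ℤ) - 1 ∣ m) :
    Psi θ r P (m : P.Post) = ((r ^ m * psiTilde r m : ℚ) : P.Omega) := by
  have := charZero_Omega P
  rw [Psi_natCast hr hθ hP, princ_pow_eq hr hP hm, Rat.cast_mul, Rat.cast_pow]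

end IncGamma

end

theorem mainTheorem2 (r : ℚ) (hr : r ≠ 0) (θ : ℝ)
    (hθ : r < 0 → (r : ℂ) ∉ IncGamma.ray θ) :
    (∃ a : ℕ → ℚ, a 0 = 1 ∧ (∀ m : ℕ, 1 ≤ m → a m = 1 + (m : ℚ) / r * a (m - 1)) ∧
      ∀ P : IncGamma.RatPlace, P ∉ IncGamma.badPlaces r → ∀ m : ℕ,
        (IncGamma.princ P (r : P.Omega)) ^ (-(m : ℤ)) * IncGamma.Psi θ r P (m : P.Post) =
          (a m : P.Omega)) ∧
    (∀ P Q : IncGamma.RatPlace, P ∉ IncGamma.badPlaces r → Q ∉ IncGamma.badPlaces r →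
      ∀ m : ℕ, Int.lcm ((P.resChar : ℤ) - 1) ((Q.resChar : ℤ) - 1) ∣ m →
        ∃ c : ℚ, IncGamma.Psi θ r P (m : P.Post) = (c : P.Omega) ∧
          IncGamma.Psi θ r Q (m : Q.Post) = (c : Q.Omega)) := by
  refine ⟨⟨IncGamma.psiTilde r, rfl, fun m hm => ?_, fun P hP m => ?_⟩, fun P Q hP hQ m hm => ?_⟩
  · obtain ⟨k, rfl⟩ := Nat.exists_eq_add_of_le' hm
    simp [IncGamma.psiTilde]
  · rw [IncGamma.Psi_natCast hr hθ hP, zpow_neg, zpow_natCast,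
      inv_mul_cancel_left₀ (pow_ne_zero m (IncGamma.princ_ne_zero hr P))]
  · have h : ((Int.lcm ((P.resChar : ℤ) - 1) ((Q.resChar : ℤ) - 1) : ℕ) : ℤ) ∣ (m : ℤ) :=
      Int.natCast_dvd_natCast.mpr hm
    exact ⟨r ^ m * IncGamma.psiTilde r m,
      IncGamma.Psi_natCast_eq_ratCast hr hθ hP ((Int.dvd_lcm_left _ _).trans h),
      IncGamma.Psi_natCast_eq_ratCast hr hθ hQ ((Int.dvd_lcm_right _ _).trans h)⟩
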